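/- Let $k$ be a field, $S=k[x_1,\ldots,x_n]$, and let $M\neq S$ be a monomial ideal minimally generated by monomials $m_1,\ldots,m_r$. Let $L_M$ be the lcm-lattice of $M$, i.e. the set of least common multiples of subsets of $\{m_1,\ldots,m_r\}$ ordered by divisibility (with bottom element $1$), and let $\mathrm{rk}(m)$ be the maximal length of a chain in $L_M$ from $1$ to $m$. Let $(\Omega,d)$ be the full simplex on $\{1,\ldots,r\}$ with its augmented simplicial boundary map over $k$ (the empty face included); a face $A$ is put in homological degree $|A|$ and has multidegree $\mathrm{mdeg}(A)=\mathrm{lcm}(m_i\mid i\in A)$. For $m\in L_M$ put $A_m=\{i\mid m_i \text{ divides } m\}$, let $\Omega_m$ be the simplex on $A_m$, and for $m\ne 1$ let $\Delta_m$ be the simplicial complex whose facets are the sets $A_{m'}$ for the elements $m'$ covered by $m$ in $L_M$. Chains are $k$-linear combinations of faces of one and the same dimension. *Frames and homogenization.* An $r$-frame is a finite complex $\mathbb V$ of finite-dimensional $k$-vector spaces with fixed bases such that $V_0=k$, $V_1=k^r$, and every basis vector of $V_1$ has differential $1$. Its $M$-homogenization is the complex of multigraded free $S$-modules with the same basis elements,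 where the basis element of degree $0$ has multidegree $1$, the basis elements of degree $1$ have multidegrees $m_1,\ldots,m_r$, and inductively, if $\partial(v)=\sum_s\alpha_s u_s$ in $\mathbb V$ with $v$ of degree at least $2$, then $\mathrm{mdeg}(v)=\mathrm{lcm}(\mathrm{mdeg}(u_s)\mid\alpha_s\ne0)$; the differential is $d(v)=\sum_s\alpha_s\frac{\mathrm{mdeg}(v)}{\mathrm{mdeg}(u_s)}u_s$ in every positive degree. *Taylor bases.* Let $\mathbf T$ be the Taylor resolution of $S/M$, with the faces of $\Omega$ as its multigraded basis. A family of chains indexed by the fixed basis of a minimal free resolution $\mathbf F$ of $S/M$ is a Taylor basis of $\mathbf F$ if there are a trivial complex $\mathcal E$ (a direct sum of complexes $0\to S(-u)\xrightarrow{1}S(-u)\to0$) and a multigraded change of basis of $\mathbf T$ after which $\mathbf T$ becomes $\mathbf F\oplus\mathcal E$ (as complexes with fixed bases), such that the chains are obtained from the new basis elements belonging to $\mathbf F$ by setting $x_1=\cdots=x_n=1$. **Theorem.** Let $e_1^1=\emptyset$ and $e_1^{m_i}=\{i\}$ for $1\le i\le r$ be the only chosen chains at $1,m_1,\ldots,m_r$.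 For every $m\in L_M$ with $\mathrm{rk}(m)\ge2$ let $e_1^m,\ldots,e_{t_m}^m$ be chains in $\Omega_m$ such that $d(e_1^m),\ldots,d(e_{t_m}^m)$ are cycles of $\Delta_m$ whose classes form a basis of the total reduced homology $\widetilde H(\Delta_m;k)=\bigoplus_i\widetilde H_i(\Delta_m;k)$. Let $B=\{e_i^m\mid m\in L_M,\ i\ge1\}$, and assume that for every $m\ne1$ in $L_M$ each $d(e_i^m)$ is a $k$-linear combination of chains $e_j^{\widetilde m}$ with $\widetilde m<m$ in $L_M$. Then applying $d$ to the elements of $B$ gives an $r$-frame $(\mathbb V,d)$ with basis $B$ (the basis vectors of $V_1$ being the vertices $\{1\},\ldots,\{r\}$), and the $M$-homogenization of $(\mathbb V,d)$ is a multigraded minimal free resolution of $S/M$ with Taylor basis $B$. -/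

import Mathlib

open MvPolynomial

namespace MonomialResolution

noncomputable section

/-! ### Monomials and the lcm-lattice

A monomial of `k[x_1, …, x_n]` is given by its exponent vector in `Fin n →₀ ℕ`. Divisibility is then
the pointwise order, the least common multiple is `⊔`, and the monomial `1` is `0`. The minimal
generators of the ideal are a family `m : Fin r → (Fin n →₀ ℕ)`. -/

variable {n r : ℕ}

/-- The monomial ideal generated by the monomials `m_1, …, m_r`. -/
def monomialIdeal (k : Type*) [Field k] (m : Fin r → (Fin n →₀ ℕ)) :
    Ideal (MvPolynomial (Fin n) k) :=
  Ideal.span (Set.range fun i => monomial (m i) (1 : k))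

/-- The monomials `m_1, …, m_r` form a minimal generating set: none of them lies in the ideal
generated by the other ones. -/
def IsMinimalGenerators (k : Type*) [Field k] (m : Fin r → (Fin n →₀ ℕ)) : Prop :=
  ∀ i, monomial (m i) (1 : k) ∉ Ideal.span ((fun j => monomial (m j) (1 : k)) '' {j | j ≠ i})

/-- The multidegree of a face `A`: the least common multiple of the `m_i` with `i ∈ A`. -/
def mdeg (m : Fin r → (Fin n →₀ ℕ)) (A : Finset (Fin r)) : Fin n →₀ ℕ := A.sup m

/-- The lcm-lattice: all least common multiples of subsets of `{m_1, …, m_r}`, ordered by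
divisibility. -/
abbrev LcmLattice (m : Fin r → (Fin n →₀ ℕ)) : Type :=
  {u : Fin n →₀ ℕ // u ∈ Set.range (mdeg m)}

/-- The bottom element `1` of the lcm-lattice. -/
def LcmLattice.one (m : Fin r → (Fin n →₀ ℕ)) : LcmLattice m := ⟨0, ∅, rfl⟩

/-- The element `m_i` of the lcm-lattice. -/
def LcmLattice.gen (m : Fin r → (Fin n →₀ ℕ)) (i : Fin r) : LcmLattice m :=
  ⟨m i, {i}, by simp [mdeg]⟩

/-- The label `A_u = {i | m_i divides u}`, which is also the vertex set of the simplex `Ω_u`. -/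
def label (m : Fin r → (Fin n →₀ ℕ)) (u : LcmLattice m) : Set (Fin r) := {i | m i ≤ u.1}

/-- The rank of `u`: the maximal length of the chains in the lcm-lattice from the bottom element
to `u`. -/
def rank (m : Fin r → (Fin n →₀ ℕ)) (u : LcmLattice m) : ℕ∞ := Order.height u

/-- The (faces of the) simplex `Ω_u` on the vertex set `A_u`, including the empty face. -/
def simplexAt (m : Fin r → (Fin n →₀ ℕ)) (u : LcmLattice m) : Set (Finset (Fin r)) :=
  {A | (A : Set (Fin r)) ⊆ label m u}

/-- The (faces of the) simplicial complex `Δ_u`, whose facets are the labels `A_v` of the elements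
`v` covered by `u` in the lcm-lattice. -/
def complexAt (m : Fin r → (Fin n →₀ ℕ)) (u : LcmLattice m) : Set (Finset (Fin r)) :=
  {A | ∃ v : LcmLattice m, v ⋖ u ∧ (A : Set (Fin r)) ⊆ label m v}

/-! ### Augmented simplicial chains and reduced homology -/

variable {k : Type*} [Field k]

/-- The augmented chains of the full simplex `Ω` on `{1, …, r}`, all dimensions together; a face
`A` has dimension `A.card - 1`, and homological degree `A.card` after the shift by one. -/
abbrev Chain (k : Type*) [Field k] (r : ℕ) : Type _ := Finset (Fin r) → k

/-- The boundary of a face: `d [i_0 < ⋯ < i_p] = ∑_j (-1) ^ j [i_0, …, î_j, …, i_p]`. -/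
def faceBoundary (k : Type*) [Field k] (A : Finset (Fin r)) : Chain k r :=
  ∑ i ∈ A, Pi.single (A.erase i) ((-1 : k) ^ (A.filter (· < i)).card)

/-- The boundary map `d` of the augmented chain complex of `Ω`. -/
def boundary (k : Type*) [Field k] (r : ℕ) : Chain k r →ₗ[k] Chain k r :=
  Fintype.linearCombination k (faceBoundary k)

/-- Augmented chains supported on a set `Δ` of faces. -/
def chains (k : Type*) [Field k] (Δ : Set (Finset (Fin r))) : Submodule k (Chain k r) where
  carrier := {c | ∀ A, A ∉ Δ → c A = 0}
  zero_mem' _ _ := rfl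
  add_mem' hc hc' A hA := by simp [hc A hA, hc' A hA]
  smul_mem' a c hc A hA := by simp [hc A hA]

/-- The cycles of `Δ`. -/
def cycles (k : Type*) [Field k] (Δ : Set (Finset (Fin r))) : Submodule k (Chain k r) :=
  chains k Δ ⊓ LinearMap.ker (boundary k r)

/-- The boundaries of `Δ`. -/
def boundaries (k : Type*) [Field k] (Δ : Set (Finset (Fin r))) : Submodule k (Chain k r) :=
  (chains k Δ).map (boundary k r)

/-- The total reduced homology `H̃(Δ; k) = ⨁_i H̃_i(Δ; k)` of a simplicial complex `Δ`. -/
abbrev ReducedHomology (k : Type*) [Field k] (Δ : Set (Finset (Fin r))) : Type _ :=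
  ↥(cycles k Δ) ⧸ (boundaries k Δ).submoduleOf (cycles k Δ)

/-- The chains `z_j` are cycles of `Δ` and their classes `[z_j]` form a basis of `H̃(Δ; k)`. -/
def IsHomologyBasis (Δ : Set (Finset (Fin r))) {κ : Type*} (z : κ → Chain k r) : Prop :=
  ∃ (hz : ∀ j, z j ∈ cycles k Δ) (b : Module.Basis κ k (ReducedHomology k Δ)),
    ∀ j, b j = Submodule.Quotient.mk ⟨z j, hz j⟩

theorem boundary_single (A : Finset (Fin r)) :
    boundary k r (Pi.single A 1) = faceBoundary k A := by
  simp [boundary]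

theorem boundary_faceBoundary (A : Finset (Fin r)) :
    boundary k r (faceBoundary k A) = 0 := by
  have h1 : boundary k r (faceBoundary k A) =
      ∑ i ∈ A, ∑ j ∈ A.erase i, Pi.single ((A.erase i).erase j)
        ((-1 : k) ^ (A.filter (· < i)).card * (-1) ^ ((A.erase i).filter (· < j)).card) := by
    simp only [faceBoundary, map_sum]
    refine Finset.sum_congr rfl fun i _ => ?_
    simp [boundary, faceBoundary, Finset.smul_sum, ← Pi.single_smul]
  have key : ∀ i ∈ A, ∀ j ∈ A, i < j →
      (-1 : k) ^ (A.filter (· < i)).card * (-1) ^ ((A.erase i).filter (· < j)).card =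
      -((-1 : k) ^ (A.filter (· < j)).card * (-1) ^ ((A.erase j).filter (· < i)).card) := by
    intro i hi j hj hij
    have e1 : ((A.erase j).filter (· < i)) = A.filter (· < i) := by
      ext a; simp only [Finset.mem_filter, Finset.mem_erase]
      constructor
      · rintro ⟨⟨_, h⟩, h'⟩; exact ⟨h, h'⟩
      · rintro ⟨h, h'⟩; exact ⟨⟨(h'.trans hij).ne, h⟩, h'⟩
    have e2 : (A.filter (· < j)).card = ((A.erase i).filter (· < j)).card + 1 := by
      rw [Finset.filter_erase, Finset.card_erase_add_one]
      simp [hi, hij]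
    rw [e1, e2]; ring
  rw [h1, Finset.sum_sigma']
  refine Finset.sum_involution (fun x _ => ⟨x.2, x.1⟩) ?_ ?_ ?_ ?_
  · rintro ⟨i, j⟩ h
    simp only [Finset.mem_sigma, Finset.mem_erase] at h
    obtain ⟨hi, hji, hj⟩ := h
    simp only
    rw [Finset.erase_right_comm, ← Pi.single_add]
    rcases lt_or_gt_of_ne hji with hlt | hlt
    · rw [key j hj i hi hlt]; simp
    · rw [key i hi j hj hlt]; simp
  · rintro ⟨i, j⟩ h _ heq
    simp only [Finset.mem_sigma, Finset.mem_erase] at h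
    simp only [Sigma.mk.injEq] at heq
    exact h.2.1 heq.1
  · rintro ⟨i, j⟩ h
    simp only [Finset.mem_sigma, Finset.mem_erase] at h ⊢
    exact ⟨h.2.2, Ne.symm h.2.1, h.1⟩
  · rintro ⟨i, j⟩ h; rfl

theorem faceBoundary_apply_eq_zero {A B : Finset (Fin r)} (h : ¬ (A ⊆ B ∧ A.card + 1 = B.card)) :
    faceBoundary k B A = 0 := by
  rw [faceBoundary, Finset.sum_apply]
  refine Finset.sum_eq_zero fun i hi => Pi.single_eq_of_ne (fun hA => ?_) _
  subst hA
  exact h ⟨Finset.erase_subset _ _, Finset.card_erase_add_one hi⟩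

/-! ### Complexes with fixed bases -/

/-- An `r`-frame: a finite complex `(U, ∂)` of finite dimensional `k`-vector spaces with fixed bases
(`d i` is the matrix of `∂ : U_{i+1} → U_i`), with `U_0 = k`, `U_1 = k ^ r`, and `∂ w = 1` for each
basis vector `w` of `U_1`. -/
structure Frame (k : Type*) [Field k] (r : ℕ) where
  ι : ℕ → Type
  [fin : ∀ i, Fintype (ι i)]
  d : ∀ i, Matrix (ι i) (ι (i + 1)) k
  d_comp : ∀ i, d i * d (i + 1) = 0
  bounded : ∃ N, ∀ i, N ≤ i → IsEmpty (ι i)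
  base : Unique (ι 0)
  vertex : Fin r ≃ ι 1
  d_vertex : ∀ a j, d 0 a (vertex j) = 1

attribute [instance] Frame.fin

/-- A finite complex of multigraded free modules `F_i = ⨁_{b : ι i} S(-x ^ (deg b))` over
`S = k[x_1, …, x_n]` with fixed multigraded bases; `d i` is the matrix of the multigraded
differential `F_{i+1} → F_i`. -/
structure MultigradedComplex (k : Type*) [Field k] (n : ℕ) where
  ι : ℕ → Type
  [fin : ∀ i, Fintype (ι i)]
  deg : ∀ i, ι i → (Fin n →₀ ℕ)
  d : ∀ i, Matrix (ι i) (ι (i + 1)) (MvPolynomial (Fin n) k)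
  homogeneous : ∀ i a b, d i a b ≠ 0 →
    deg i a ≤ deg (i + 1) b ∧ ∃ c : k, d i a b = monomial (deg (i + 1) b - deg i a) c
  d_comp : ∀ i, d i * d (i + 1) = 0
  bounded : ∃ N, ∀ i, N ≤ i → IsEmpty (ι i)

attribute [instance] MultigradedComplex.fin

/-- The complex of multigraded free `S`-modules obtained from a based complex of `k`-vector spaces
with matrices `d` by assigning multidegrees to the basis vectors and multiplying each matrix entry by
the quotient of the multidegrees. -/
def MultigradedComplex.ofScalars {ι : ℕ → Type} [∀ i, Fintype (ι i)]
    (deg : ∀ i, ι i → (Fin n →₀ ℕ)) (d : ∀ i, Matrix (ι i) (ι (i + 1)) k)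
    (d_comp : ∀ i, d i * d (i + 1) = 0) (bounded : ∃ N, ∀ i, N ≤ i → IsEmpty (ι i))
    (hle : ∀ i a b, d i a b ≠ 0 → deg i a ≤ deg (i + 1) b) : MultigradedComplex k n where
  ι := ι
  deg := deg
  d i := Matrix.of fun a b => monomial (deg (i + 1) b - deg i a) (d i a b)
  homogeneous i a b h := by
    refine ⟨hle i a b ?_, d i a b, rfl⟩
    intro h0
    exact h (by simp [h0])
  d_comp i := by
    ext1 a c
    have : ∀ b, monomial (deg (i + 1) b - deg i a) (d i a b) *
        monomial (deg (i + 1 + 1) c - deg (i + 1) b) (d (i + 1) b c) =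
        monomial (deg (i + 1 + 1) c - deg i a) (d i a b * d (i + 1) b c) := by
      intro b
      rw [monomial_mul]
      by_cases h1 : d i a b = 0
      · simp [h1]
      by_cases h2 : d (i + 1) b c = 0
      · simp [h2]
      rw [add_comm, tsub_add_tsub_cancel (hle _ _ _ h2) (hle _ _ _ h1)]
    have h0 := congrFun (congrFun (d_comp i) a) c
    rw [Matrix.mul_apply] at h0
    simp only [Matrix.mul_apply, Matrix.of_apply, this, ← map_sum, h0]
    simp
  bounded := bounded

/-! ### The `M`-homogenization of an `r`-frame -/

open Classical in
/-- The multidegrees of the basis elements in the `M`-homogenization: `1` in homological degree `0`,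
`m_1, …, m_r` in homological degree `1`, and after that the least common multiple of the multidegrees
of the basis elements that occur in the differential. -/
def Frame.deg (V : Frame k r) (m : Fin r → (Fin n →₀ ℕ)) : ∀ i, V.ι i → (Fin n →₀ ℕ)
  | 0 => fun _ => 0
  | 1 => fun b => m (V.vertex.symm b)
  | i + 2 => fun b => (Finset.univ.filter fun a => V.d (i + 1) a b ≠ 0).sup (V.deg m (i + 1))

theorem Frame.deg_le (V : Frame k r) (m : Fin r → (Fin n →₀ ℕ)) (i : ℕ) (a : V.ι i)
    (b : V.ι (i + 1)) (h : V.d i a b ≠ 0) : V.deg m i a ≤ V.deg m (i + 1) b := by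
  classical
  cases i with
  | zero => simp [Frame.deg]
  | succ i =>
    rw [Frame.deg]
    exact Finset.le_sup (f := V.deg m (i + 1)) (by simp [h])

/-- The `M`-homogenization of an `r`-frame, for `M` generated by `m_1, …, m_r`. -/
def Frame.homogenization (V : Frame k r) (m : Fin r → (Fin n →₀ ℕ)) : MultigradedComplex k n :=
  .ofScalars (V.deg m) V.d V.d_comp V.bounded (V.deg_le m)

/-! ### Minimal free resolutions -/

/-- `F` is a (multigraded) minimal free resolution of `S / I`. -/
def MultigradedComplex.IsMinimalFreeResolution (F : MultigradedComplex k n)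
    (I : Ideal (MvPolynomial (Fin n) k)) : Prop :=
  (∃ ε : (F.ι 0 → MvPolynomial (Fin n) k) →ₗ[MvPolynomial (Fin n) k] MvPolynomial (Fin n) k ⧸ I,
    (∀ (v : F.ι 0 → MvPolynomial (Fin n) k) (u : Fin n →₀ ℕ),
      (∀ a, v a ≠ 0 → F.deg 0 a ≤ u ∧ ∃ c : k, v a = monomial (u - F.deg 0 a) c) →
        ∃ c : k, ε v = Ideal.Quotient.mk I (monomial u c)) ∧
    Function.Surjective ε ∧ Function.Exact (F.d 0).mulVecLin ε) ∧
  (∀ i, Function.Exact (F.d (i + 1)).mulVecLin (F.d i).mulVecLin) ∧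
  (∀ i, LinearMap.range (F.d i).mulVecLin ≤
    Ideal.span (Set.range (X : Fin n → MvPolynomial (Fin n) k)) •
      (⊤ : Submodule (MvPolynomial (Fin n) k) (F.ι i → MvPolynomial (Fin n) k)))

/-! ### The Taylor resolution and Taylor bases -/

/-- The Taylor resolution of `S / M`, with the faces of `Ω` as its basis. -/
def taylor (k : Type*) [Field k] (m : Fin r → (Fin n →₀ ℕ)) : MultigradedComplex k n :=
  .ofScalars (ι := fun i => {A : Finset (Fin r) // A.card = i})
    (fun _ A => mdeg m A.1) (fun _ => Matrix.of fun A B => faceBoundary k B.1 A.1)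
    (by
      intro i
      ext A C
      have h2 := congrFun (boundary_faceBoundary (k := k) C.1) A.1
      simp only [boundary, Fintype.linearCombination_apply, Finset.sum_apply, Pi.smul_apply,
        smul_eq_mul, Pi.zero_apply] at h2
      rw [Matrix.mul_apply, Matrix.zero_apply, ← h2,
        ← Finset.sum_subset (Finset.subset_univ
          (Finset.univ.filter fun B : Finset (Fin r) => B.card = i + 1)),
        Finset.sum_subtype (p := fun B : Finset (Fin r) => B.card = i + 1) _ (by simp)]
      · exact Finset.sum_congr rfl fun B _ => mul_comm _ _
      · intro B _ hB
        rw [faceBoundary_apply_eq_zero, zero_mul]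
        rintro ⟨_, h⟩
        have := C.2
        simp only [Finset.mem_filter, Finset.mem_univ, true_and] at hB
        omega)
    ⟨r + 1, fun i hi => ⟨fun A => by
      have := A.2
      have := Finset.card_le_univ A.1
      simp at this
      omega⟩⟩
    (by
      intro i A B h
      by_contra hle
      refine h (faceBoundary_apply_eq_zero ?_)
      rintro ⟨hs, -⟩
      exact hle (Finset.sup_mono hs))

/-- The direct sum of two complexes, with the union of the two fixed bases. -/
def MultigradedComplex.directSum (F G : MultigradedComplex k n) : MultigradedComplex k n where
  ι i := F.ι i ⊕ G.ι i
  deg i := Sum.elim (F.deg i) (G.deg i)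
  d i := Matrix.fromBlocks (F.d i) 0 0 (G.d i)
  homogeneous i a b := by
    rcases a with a | a <;> rcases b with b | b
    · simpa using F.homogeneous i a b
    · simp
    · simp
    · simpa using G.homogeneous i a b
  d_comp i := by simp [Matrix.fromBlocks_multiply, F.d_comp, G.d_comp]
  bounded := by
    obtain ⟨N, hN⟩ := F.bounded
    obtain ⟨N', hN'⟩ := G.bounded
    refine ⟨max N N', fun i hi => ?_⟩
    have := hN i (le_of_max_le_left hi)
    have := hN' i (le_of_max_le_right hi)
    infer_instance

open Classical in
/-- `E` is a trivial complex: a direct sum of short trivial complexes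
`0 → S(-u) → S(-u) → 0` with differential `1`. The basis elements in `src` are the sources of these
short complexes, the other ones are the targets. -/
def MultigradedComplex.IsTrivial (E : MultigradedComplex k n) : Prop :=
  ∃ (src : ∀ i, Set (E.ι i)) (pair : ∀ i, ↥(src i)ᶜ ≃ ↥(src (i + 1))),
    src 0 = ∅ ∧
    (∀ i (a : ↥(src i)ᶜ), E.deg (i + 1) (pair i a).1 = E.deg i a.1) ∧
    (∀ i a b, b ∉ src (i + 1) → E.d i a b = 0) ∧
    (∀ i a (c : ↥(src i)ᶜ), E.d i a (pair i c).1 = if a = c.1 then 1 else 0)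

/-- The family `f` is a new multigraded basis of the complex `T`, and `G` is the complex `T` written
in this new basis (so that `σ(T) = G` for the change of basis map `σ` given by `f`). -/
def MultigradedComplex.IsChangeOfBasis (T G : MultigradedComplex k n)
    (f : ∀ i, Module.Basis (G.ι i) (MvPolynomial (Fin n) k) (T.ι i → MvPolynomial (Fin n) k)) :
    Prop :=
  (∀ i b a, f i b a ≠ 0 →
    T.deg i a ≤ G.deg i b ∧ ∃ c : k, f i b a = monomial (G.deg i b - T.deg i a) c) ∧
  (∀ i b, (T.d i).mulVec (f (i + 1) b) = ∑ a, G.d i a b • f i a)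

/-- The dehomogenization of an element of the Taylor resolution in homological degree `i`: set
`x_1 = ⋯ = x_n = 1`. -/
def dehomogenize (m : Fin r → (Fin n →₀ ℕ)) (i : ℕ)
    (f : (taylor k m).ι i → MvPolynomial (Fin n) k) : Chain k r :=
  ∑ A : {A : Finset (Fin r) // A.card = i}, Pi.single A.1 (eval (fun _ => (1 : k)) (f A))

/-- The chains `g` form a Taylor basis of `F` (`g i b` belongs to the basis element `b` of `F_i`):
there are a trivial complex `E` and a change of basis map `σ` of the Taylor resolution `T` with
`σ(T) = F ⊕ E`, such that the `g i b` are the dehomogenizations of those elements of the new basis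
that belong to `F`. -/
def IsTaylorBasis (m : Fin r → (Fin n →₀ ℕ)) (F : MultigradedComplex k n)
    (g : ∀ i, F.ι i → Chain k r) : Prop :=
  ∃ (E : MultigradedComplex k n)
    (f : ∀ i, Module.Basis ((F.directSum E).ι i) (MvPolynomial (Fin n) k)
      ((taylor k m).ι i → MvPolynomial (Fin n) k)),
    E.IsTrivial ∧ (taylor k m).IsChangeOfBasis (F.directSum E) f ∧
    ∀ i b, g i b = dehomogenize m i (f i (Sum.inl b))

/-! ### The complex obtained by applying the boundary map to a set of chains -/

/-- The `r`-frame `V` is the complex obtained by applying the boundary map `d` of `Ω` to the chains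
`e b` (`b : β`), where `e b` is in homological degree `δ b`: the map `φ` identifies the fixed basis
of `V_i` with the chains of homological degree `i`, and the differential of `V` is `d`, written in
terms of the chains. The `j`-th basis vector of `V_1` is the vertex `{j}`. -/
def Frame.IsObtainedFrom (V : Frame k r) {β : Type*} (e : β → Chain k r) (δ : β → ℕ)
    (φ : ∀ i, V.ι i ≃ {b : β // δ b = i}) : Prop :=
  (∀ i b, boundary k r (e (φ (i + 1) b).1) = ∑ a, V.d i a b • e (φ i a).1) ∧
  (∀ j, e (φ 1 (V.vertex j)).1 = Pi.single {j} 1)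

end

end MonomialResolution

open MonomialResolution

open MvPolynomial

namespace MonomialResolution

noncomputable section

section

variable {n r : ℕ} {k : Type*} [Field k]

/-! ### Chains and the boundary map -/

/-! Setting all variables to 1 turns the Taylor resolution into the augmented chain complex of the
full simplex, filtered by multidegree: `chainsLE` and `chainsLT` at `u` are the chains of `Ω_u` and
`Δ_u`. Conversely, a scalar matrix that respects multidegrees can be homogenized, and homogenization
is multiplicative (`homogenize_mul`). Hence everything reduces to linear algebra of a filtered
complex over `k`.

For `u ≠ 1` the simplex `Ω_u` is acyclic, by coning from a vertex, so the boundary identifies the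
relative homology of `(Ω_u, Δ_u)` with the reduced homology of `Δ_u` up to a shift. The chosen
chains therefore represent a basis of the homology of the associated graded complex in multidegree
`u` (`IsRelHomologyBasis.of_isHomologyBasis`); at `1` and at the generators this is checked by hand.

The associated graded differential is `mdegBoundary`. Choose faces `a x` whose images under it form
a basis of its range. Then the chains `e u j`, the faces `a x` and their boundaries form a basis of
all chains compatible with the filtration: spanning goes by induction up the lcm-lattice
(`chainsLE_le_span`), independence by induction down it (`linearIndependent_adaptedFamily`). The
pairs consisting of `a x` and its boundary span a trivial complex. The assumption that each `d (e u
j)` is a combination of chains with smaller labels makes the `e u j` span a complementary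
subcomplex, namely the frame.

The homogenized multidegree of `e u j` is exactly `u` (`frame_deg_eq`): otherwise `d (e u j)` would
already bound in `Δ_u`, and the class of `e u j` would vanish. Homogenizing the basis now splits the
Taylor resolution into the homogenized frame and a trivial complex (`isTaylorBasis`). Exactness is
tested multidegree by multidegree: bound a cycle inside a simplex and project to the `e`-coordinates
(`frame_exists_mulVec_eq`). Minimality holds because labels strictly decrease along the
differential. -/

theorem chains_mono {Δ Δ' : Set (Finset (Fin r))} (h : Δ ⊆ Δ') : chains k Δ ≤ chains k Δ' :=
  fun _ hc A hA => hc A fun hA' => hA (h hA')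

theorem single_mem_chains {Δ : Set (Finset (Fin r))} {A : Finset (Fin r)} (hA : A ∈ Δ) (c : k) :
    (Pi.single A c : Chain k r) ∈ chains k Δ :=
  fun B hB => Pi.single_eq_of_ne (fun h : B = A => hB (by rwa [h])) _

theorem chain_eq_sum (x : Chain k r) : x = ∑ A, x A • (Pi.single A 1 : Chain k r) := by
  ext B
  simp [Finset.sum_apply, Pi.single_apply]

/-- Reduces linear identities on chains to faces: take `S` to be a kernel or a preimage, with `Δ =
Set.univ` for identities on all chains. -/
theorem mem_of_single_mem {Δ : Set (Finset (Fin r))} {S : Submodule k (Chain k r)}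
    (h : ∀ A ∈ Δ, (Pi.single A 1 : Chain k r) ∈ S) {x : Chain k r} (hx : x ∈ chains k Δ) :
    x ∈ S := by
  rw [chain_eq_sum x]
  refine S.sum_mem fun A _ => ?_
  by_cases hA : A ∈ Δ
  · exact S.smul_mem _ (h A hA)
  · simp [hx A hA]

theorem faceBoundary_mem_chains {Δ : Set (Finset (Fin r))} {A : Finset (Fin r)}
    (h : ∀ i ∈ A, A.erase i ∈ Δ) : faceBoundary k A ∈ chains k Δ :=
  Submodule.sum_mem _ fun i hi => single_mem_chains (h i hi) _

theorem boundary_mem_chains {Δ Δ' : Set (Finset (Fin r))}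
    (h : ∀ A ∈ Δ, ∀ i ∈ A, A.erase i ∈ Δ') {x : Chain k r} (hx : x ∈ chains k Δ) :
    boundary k r x ∈ chains k Δ' := by
  refine mem_of_single_mem (S := (chains k Δ').comap (boundary k r)) (fun A hA => ?_) hx
  rw [Submodule.mem_comap, boundary_single]
  exact faceBoundary_mem_chains (h A hA)

theorem boundary_boundary (x : Chain k r) : boundary k r (boundary k r x) = 0 := by
  refine mem_of_single_mem (Δ := Set.univ)
    (S := LinearMap.ker (boundary k r ∘ₗ boundary k r)) (fun A _ => ?_) (fun A hA => by simp at hA)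
  simp [boundary_single, boundary_faceBoundary]

theorem boundary_mem_card {i : ℕ} {x : Chain k r}
    (hx : x ∈ chains k {A : Finset (Fin r) | A.card = i + 1}) :
    boundary k r x ∈ chains k {A : Finset (Fin r) | A.card = i} :=
  boundary_mem_chains (fun A hA j hj => by
    have := Finset.card_erase_add_one hj
    simp only [Set.mem_ofPred_eq] at hA ⊢
    omega) hx

theorem boundary_eq_zero_of_card {x : Chain k r}
    (hx : x ∈ chains k {A : Finset (Fin r) | A.card = 0}) : boundary k r x = 0 := by
  refine mem_of_single_mem (S := LinearMap.ker (boundary k r)) (fun A hA => ?_) hx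
  obtain rfl := Finset.card_eq_zero.1 hA
  simp [boundary_single, faceBoundary]

/-! ### Contracting homotopy of the simplex -/

/-- The sign of the face `A.erase i` in the boundary of `A`. -/
def faceSign (k : Type*) [Field k] (A : Finset (Fin r)) (i : Fin r) : k :=
  (-1) ^ (A.filter (· < i)).card

theorem faceSign_mul_self (A : Finset (Fin r)) (i : Fin r) :
    faceSign k A i * faceSign k A i = 1 := by
  rw [faceSign, ← mul_pow]; simp

theorem faceSign_erase_self (A : Finset (Fin r)) (i : Fin r) :
    faceSign k (A.erase i) i = faceSign k A i := by
  have : (A.erase i).filter (· < i) = A.filter (· < i) := by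
    ext a; simp only [Finset.mem_filter, Finset.mem_erase]
    exact ⟨fun h => ⟨h.1.2, h.2⟩, fun h => ⟨⟨h.2.ne, h.1⟩, h.2⟩⟩
  rw [faceSign, faceSign, this]

theorem faceSign_erase_of_lt {A : Finset (Fin r)} {i j : Fin r} (hij : i < j) :
    faceSign k (A.erase j) i = faceSign k A i := by
  have : (A.erase j).filter (· < i) = A.filter (· < i) := by
    ext a; simp only [Finset.mem_filter, Finset.mem_erase]
    exact ⟨fun h => ⟨h.1.2, h.2⟩, fun h => ⟨⟨(h.2.trans hij).ne, h.1⟩, h.2⟩⟩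
  rw [faceSign, faceSign, this]

theorem faceSign_erase_of_gt {A : Finset (Fin r)} {i j : Fin r} (hi : i ∈ A) (hij : i < j) :
    faceSign k (A.erase i) j = -faceSign k A j := by
  have : (A.filter (· < j)).card = ((A.erase i).filter (· < j)).card + 1 := by
    rw [Finset.filter_erase, Finset.card_erase_add_one]
    simp [hi, hij]
  rw [faceSign, faceSign, this]; ring

/-- Deleting the smaller of two vertices shifts the position of the larger one by one, while the
opposite deletion shifts nothing. This sign change drives the cancellation in the cone formula. -/
theorem faceSign_mul_faceSign {A : Finset (Fin r)} {i j : Fin r} (hi : i ∈ A) (hj : j ∈ A)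
    (hij : i ≠ j) :
    faceSign k A i * faceSign k A j = -(faceSign k (A.erase j) i * faceSign k (A.erase i) j) := by
  rcases lt_or_gt_of_ne hij with h | h
  · rw [faceSign_erase_of_lt h, faceSign_erase_of_gt hi h]; ring
  · rw [faceSign_erase_of_lt h, faceSign_erase_of_gt hj h]; ring

/-- The cone over a face, with apex `v`. -/
def faceCone (k : Type*) [Field k] (v : Fin r) (A : Finset (Fin r)) : Chain k r :=
  if v ∈ A then 0 else Pi.single (insert v A) (faceSign k A v)

/-- The cone over a chain, with apex `v`. -/
def cone (k : Type*) [Field k] (v : Fin r) : Chain k r →ₗ[k] Chain k r :=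
  Fintype.linearCombination k (faceCone k v)

theorem cone_single (v : Fin r) (A : Finset (Fin r)) (c : k) :
    cone k v (Pi.single A c) = c • faceCone k v A := by
  simp [cone]

theorem boundary_single_smul (A : Finset (Fin r)) (c : k) :
    boundary k r (Pi.single A c) = c • faceBoundary k A := by
  simp [boundary]

/-- The cone operator is a contracting homotopy of the augmented complex. On a face containing the
apex only the term deleting the apex survives; otherwise all terms but the face itself cancel in
pairs. -/
theorem boundary_cone_add (v : Fin r) (x : Chain k r) :
    boundary k r (cone k v x) + cone k v (boundary k r x) = x := by
  suffices x ∈ LinearMap.ker (boundary k r ∘ₗ cone k v + cone k v ∘ₗ boundary k r - .id) by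
    simpa [sub_eq_zero] using this
  refine mem_of_single_mem (Δ := Set.univ) (fun A _ => ?_) (fun A hA => by simp at hA)
  simp only [LinearMap.mem_ker, LinearMap.sub_apply, LinearMap.add_apply, LinearMap.comp_apply,
    LinearMap.id_apply, sub_eq_zero, boundary_single, cone_single, one_smul]
  have h1 : cone k v (faceBoundary k A) =
      ∑ i ∈ A, faceSign k A i • faceCone k v (A.erase i) := by
    simp [faceBoundary, cone_single, faceSign]
  rw [h1]
  by_cases hv : v ∈ A
  · rw [Finset.sum_eq_single_of_mem v hv]
    · simp [faceCone, hv, faceSign_erase_self, faceSign_mul_self, ← Pi.single_smul]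
    · intro i _ hi
      simp [faceCone, hv, hi.symm]
  · have h2 : boundary k r (faceCone k v A) =
        Pi.single A 1 + ∑ i ∈ A, (faceSign k A v * faceSign k (insert v A) i) •
          (Pi.single (insert v (A.erase i)) 1 : Chain k r) := by
      rw [faceCone, if_neg hv, boundary_single_smul, faceBoundary, Finset.sum_insert hv, smul_add,
        Finset.smul_sum]
      congr 1
      · have := faceSign_erase_self (k := k) (insert v A) v
        rw [Finset.erase_insert hv] at this
        rw [Finset.erase_insert hv, ← Pi.single_smul, smul_eq_mul]
        change (Pi.single A (faceSign k A v * faceSign k (insert v A) v) : Chain k r) = _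
        rw [← this, faceSign_mul_self]
      · refine Finset.sum_congr rfl fun i hi => ?_
        rw [Finset.erase_insert_of_ne (by rintro rfl; exact hv hi), ← Pi.single_smul,
          ← Pi.single_smul, smul_eq_mul, smul_eq_mul, mul_one]
        rfl
    rw [h2, add_assoc, ← Finset.sum_add_distrib, Finset.sum_eq_zero, add_zero]
    intro i hi
    have hiv : i ≠ v := by rintro rfl; exact hv hi
    have h3 := faceSign_mul_faceSign (k := k) (Finset.mem_insert_of_mem hi : i ∈ insert v A)
      (Finset.mem_insert_self v A) hiv
    have h4 := faceSign_erase_self (k := k) (insert v A) v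
    have h5 := faceSign_erase_self (k := k) ((insert v A).erase i) v
    rw [Finset.erase_insert hv] at h3 h4
    rw [Finset.erase_insert_of_ne hiv.symm, Finset.erase_insert (by simp [hv])] at h5
    rw [Finset.erase_insert_of_ne hiv.symm, ← h5] at h3
    rw [faceCone, if_neg (by simp [hv]), ← Pi.single_smul, ← Pi.single_smul, ← Pi.single_add,
      smul_eq_mul, smul_eq_mul, h4, mul_comm (faceSign k _ v), mul_one, h3]
    simp

/-! ### Chains of bounded multidegree -/

/-- The chains supported on the faces whose multidegree divides `w`. -/
abbrev chainsLE (k : Type*) [Field k] (m : Fin r → (Fin n →₀ ℕ)) (w : Fin n →₀ ℕ) :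
    Submodule k (Chain k r) := chains k {A | mdeg m A ≤ w}

/-- The chains supported on the faces whose multidegree strictly divides `w`. -/
abbrev chainsLT (k : Type*) [Field k] (m : Fin r → (Fin n →₀ ℕ)) (w : Fin n →₀ ℕ) :
    Submodule k (Chain k r) := chains k {A | mdeg m A < w}

variable {m : Fin r → (Fin n →₀ ℕ)}

theorem mdeg_erase_le (A : Finset (Fin r)) (i : Fin r) : mdeg m (A.erase i) ≤ mdeg m A :=
  Finset.sup_mono (Finset.erase_subset _ _)

theorem chainsLT_le (w : Fin n →₀ ℕ) : chainsLT k m w ≤ chainsLE k m w :=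
  chains_mono fun A (h : mdeg m A < w) => h.le

theorem chainsLE_mono {v w : Fin n →₀ ℕ} (h : v ≤ w) : chainsLE k m v ≤ chainsLE k m w :=
  chains_mono fun _ hA => le_trans hA h

theorem chainsLE_le_chainsLT {v w : Fin n →₀ ℕ} (h : v < w) : chainsLE k m v ≤ chainsLT k m w :=
  chains_mono fun _ hA => lt_of_le_of_lt hA h

theorem boundary_mem_chainsLE {w : Fin n →₀ ℕ} {x : Chain k r} (hx : x ∈ chainsLE k m w) :
    boundary k r x ∈ chainsLE k m w :=
  boundary_mem_chains (fun A hA i _ => (mdeg_erase_le A i).trans hA) hx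

theorem boundary_mem_chainsLT {w : Fin n →₀ ℕ} {x : Chain k r} (hx : x ∈ chainsLT k m w) :
    boundary k r x ∈ chainsLT k m w :=
  boundary_mem_chains (fun A hA i _ => (mdeg_erase_le A i).trans_lt hA) hx

/-- Coning from a vertex whose monomial divides `w` does not leave the simplex of faces of
multidegree dividing `w`. -/
theorem exists_boundary_eq_of_le {w : Fin n →₀ ℕ} {v : Fin r} (hv : m v ≤ w) {x : Chain k r}
    (hx : x ∈ chainsLE k m w) (h0 : boundary k r x = 0) :
    ∃ y ∈ chainsLE k m w, boundary k r y = x := by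
  refine ⟨cone k v x, ?_, by simpa [h0] using boundary_cone_add v x⟩
  refine mem_of_single_mem (S := (chainsLE k m w).comap (cone k v)) (fun A hA => ?_) hx
  rw [Submodule.mem_comap, cone_single, one_smul, faceCone]
  split_ifs
  · exact Submodule.zero_mem _
  · refine single_mem_chains ?_ _
    simp only [Set.mem_ofPred_eq, mdeg, Finset.sup_insert] at hA ⊢
    exact sup_le hv hA

/-- If no generator divides `w`, only the empty face is available; positive homological degree
excludes it, so the cycle is zero. -/
theorem exists_boundary_eq {w : Fin n →₀ ℕ} {i : ℕ} {x : Chain k r}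
    (hx : x ∈ chainsLE k m w) (hi : x ∈ chains k {A : Finset (Fin r) | A.card = i + 1})
    (h0 : boundary k r x = 0) : ∃ y ∈ chainsLE k m w, boundary k r y = x := by
  by_cases h : ∃ v, m v ≤ w
  · obtain ⟨v, hv⟩ := h
    exact exists_boundary_eq_of_le hv hx h0
  · refine ⟨0, Submodule.zero_mem _, ?_⟩
    rw [map_zero]
    ext A
    by_contra hA
    have h1 : A.card = i + 1 := by by_contra h; exact hA (hi A h).symm
    have h2 : mdeg m A ≤ w := by by_contra h; exact hA (hx A h).symm
    obtain ⟨v, hvA⟩ := Finset.card_pos.1 (Nat.lt_of_lt_of_eq (Nat.succ_pos i) h1.symm)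
    exact h ⟨v, (Finset.le_sup (f := m) hvA).trans h2⟩

end

section

variable {n r : ℕ} {k : Type*} [Field k]

/-! ### Local homology bases -/

/-- The chains `e j` are relative cycles of `(Ω_u, Δ_u)` whose classes form a basis of the relative
homology, where `Ω_u` and `Δ_u` consist of the faces whose multidegree divides, respectively strictly
divides, `u`. -/
structure IsRelHomologyBasis (m : Fin r → (Fin n →₀ ℕ)) (u : Fin n →₀ ℕ) {κ : Type*} [Fintype κ]
    (e : κ → Chain k r) : Prop where
  mem : ∀ j, e j ∈ chainsLE k m u
  boundary_mem : ∀ j, boundary k r (e j) ∈ chainsLT k m u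
  indep : ∀ c : κ → k, ∑ j, c j • e j ∈ chainsLT k m u ⊔ (chainsLE k m u).map (boundary k r) →
    ∀ j, c j = 0
  span : ∀ x ∈ chainsLE k m u, boundary k r x ∈ chainsLT k m u →
    ∃ c : κ → k, x - ∑ j, c j • e j ∈ chainsLT k m u ⊔ (chainsLE k m u).map (boundary k r)

variable {m : Fin r → (Fin n →₀ ℕ)}

instance finite_lcmLattice : Finite (LcmLattice m) := Set.finite_range (mdeg m)

instance fintype_lcmLattice : Fintype (LcmLattice m) := Fintype.ofFinite _

theorem mem_simplexAt {u : LcmLattice m} {A : Finset (Fin r)} :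
    A ∈ simplexAt m u ↔ mdeg m A ≤ u.1 := by
  rw [mdeg, Finset.sup_le_iff]
  exact Iff.rfl

/-- The multidegree of a face is itself an element of the lcm-lattice, and in a finite poset
everything strictly below `u` lies below an element covered by `u`. -/
theorem mem_complexAt {u : LcmLattice m} {A : Finset (Fin r)} :
    A ∈ complexAt m u ↔ mdeg m A < u.1 := by
  constructor
  · rintro ⟨v, hv, hA⟩
    exact (mem_simplexAt.1 hA).trans_lt hv.lt
  · intro h
    obtain ⟨v, hle, hv⟩ := exists_le_covBy_of_lt (a := (⟨mdeg m A, A, rfl⟩ : LcmLattice m)) h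
    exact ⟨v, hv, mem_simplexAt.2 hle⟩

theorem chains_simplexAt (u : LcmLattice m) : chains k (simplexAt m u) = chainsLE k m u.1 :=
  le_antisymm (chains_mono fun _ => mem_simplexAt.1) (chains_mono fun _ => mem_simplexAt.2)

theorem chains_complexAt (u : LcmLattice m) : chains k (complexAt m u) = chainsLT k m u.1 :=
  le_antisymm (chains_mono fun _ => mem_complexAt.1) (chains_mono fun _ => mem_complexAt.2)

/-- The connecting isomorphism of the pair `(Ω_u, Δ_u)` in terms of chains; the vertex `v` makes
`Ω_u` acyclic. -/
theorem IsRelHomologyBasis.of_isHomologyBasis {u : LcmLattice m} {v : Fin r} (hv : m v ≤ u.1)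
    {κ : Type*} [Fintype κ] {e : κ → Chain k r} (he : ∀ j, e j ∈ chains k (simplexAt m u))
    (h : IsHomologyBasis (complexAt m u) fun j => boundary k r (e j)) :
    IsRelHomologyBasis m u.1 e := by
  obtain ⟨hz, b, hb⟩ := h
  have hsum : ∀ c : κ → k, ∑ j, c j • b j = Submodule.Quotient.mk
      ⟨boundary k r (∑ j, c j • e j), by
        rw [map_sum]; exact Submodule.sum_mem _ fun j _ => by
          rw [map_smul]; exact Submodule.smul_mem _ _ (hz j)⟩ := by
    intro c
    rw [← Submodule.mkQ_apply, show (⟨boundary k r (∑ j, c j • e j), _⟩ :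
      cycles k (complexAt m u)) = ∑ j, c j • ⟨_, hz j⟩ from Subtype.ext (by simp), map_sum]
    simp only [hb, map_smul, Submodule.mkQ_apply]
  simp only [chains_simplexAt] at he
  constructor
  · exact he
  · intro j
    rw [← chains_complexAt]
    exact (hz j).1
  · intro c hc
    obtain ⟨z, hz', _, ⟨y, hy, rfl⟩, hzy⟩ := Submodule.mem_sup.1 hc
    refine Fintype.linearIndependent_iff.1 b.linearIndependent c ?_
    rw [hsum, Submodule.Quotient.mk_eq_zero, Submodule.submoduleOf, Submodule.mem_comap, boundaries,
      chains_complexAt]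
    exact ⟨z, hz', by
      change boundary k r z = boundary k r (∑ j, c j • e j)
      rw [← hzy, map_add, boundary_boundary, add_zero]⟩
  · intro x hx hdx
    have hcyc : boundary k r x ∈ cycles k (complexAt m u) := by
      rw [cycles, chains_complexAt]
      exact ⟨hdx, boundary_boundary x⟩
    have h1 := b.sum_repr (Submodule.Quotient.mk ⟨_, hcyc⟩)
    rw [hsum] at h1
    set c := b.repr (Submodule.Quotient.mk ⟨_, hcyc⟩)
    have h2 : boundary k r x - boundary k r (∑ j, c j • e j) ∈ boundaries k (complexAt m u) :=
      (Submodule.Quotient.eq ((boundaries k (complexAt m u)).submoduleOf _)).1 h1.symm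
    rw [boundaries, chains_complexAt] at h2
    obtain ⟨z, hz', hzx⟩ := h2
    refine ⟨c, ?_⟩
    -- After removing the homology part and a chain `z` of `Δ_u`, what is left of `x` is an absolute
    -- cycle of `Ω_u`, hence a boundary.
    obtain ⟨y, hy, hyx⟩ := exists_boundary_eq_of_le (x := x - ∑ j, c j • e j - z) hv
      (Submodule.sub_mem _ (Submodule.sub_mem _ hx (Submodule.sum_mem _ fun j _ =>
        Submodule.smul_mem _ _ (he j))) (chainsLT_le _ hz'))
      (by rw [map_sub, hzx, map_sub]; simp)
    exact Submodule.mem_sup.2 ⟨z, hz', _, ⟨y, hy, rfl⟩, by rw [hyx]; abel⟩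

/-! ### Relative homology bases at `1` and at the generators; ranks in the lcm-lattice -/

theorem mdeg_eq_zero_iff (hm : ∀ i, m i ≠ 0) {A : Finset (Fin r)} : mdeg m A = 0 ↔ A = ∅ := by
  refine ⟨fun h => ?_, fun h => by simp [h, mdeg, bot_eq_zero]⟩
  by_contra hA
  obtain ⟨i, hi⟩ := Finset.nonempty_iff_ne_empty.2 hA
  exact hm i (le_antisymm ((Finset.le_sup (f := m) hi).trans h.le) zero_le)

theorem mdeg_le_gen_iff (hm : ∀ i j, m i ≤ m j → i = j) {A : Finset (Fin r)} {i : Fin r} :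
    mdeg m A ≤ m i ↔ A = ∅ ∨ A = {i} := by
  rw [← Finset.subset_singleton_iff, mdeg, Finset.sup_le_iff]
  refine ⟨fun h j hj => Finset.mem_singleton.2 (hm _ _ (h j hj)), fun h j hj => ?_⟩
  rw [Finset.mem_singleton.1 (h hj)]

theorem isRelHomologyBasis_one (hm : ∀ i, m i ≠ 0) {κ : Type*} [Fintype κ] [Unique κ]
    {e : κ → Chain k r} (he : ∀ j, e j = Pi.single ∅ 1) : IsRelHomologyBasis m 0 e := by
  have hmem : ∀ {A : Finset (Fin r)}, mdeg m A ≤ 0 ↔ A = ∅ := fun {A} => by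
    rw [← mdeg_eq_zero_iff hm (A := A)]; exact le_zero_iff
  have hd : ∀ x ∈ chainsLE k m 0, boundary k r x = 0 := fun x hx =>
    boundary_eq_zero_of_card (chains_mono (fun A hA => by
      simp [hmem.1 hA]) hx)
  have hlt : ∀ x ∈ chainsLT k m 0, x = 0 := fun x hx => by
    ext A
    exact hx A (not_lt_zero (a := mdeg m A))
  constructor
  · intro j; rw [he]; exact single_mem_chains (hmem.2 rfl) _
  · intro j; rw [he, hd _ (single_mem_chains (hmem.2 rfl) _)]; exact Submodule.zero_mem _
  · intro c hc
    obtain ⟨z, hz, _, ⟨y, hy, rfl⟩, hzy⟩ := Submodule.mem_sup.1 hc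
    rw [hlt z hz, hd y hy, Fintype.sum_unique, he] at hzy
    have := congrFun hzy ∅
    intro j
    rw [Subsingleton.elim j default]
    simpa using this.symm
  · intro x hx _
    refine ⟨fun _ => x ∅, ?_⟩
    convert Submodule.zero_mem _
    rw [Fintype.sum_unique, he, sub_eq_zero]
    ext A
    by_cases hA : A = ∅
    · simp [hA]
    · simp [hA, hx A (fun h => hA (hmem.1 h))]

theorem isRelHomologyBasis_gen (hm0 : ∀ i, m i ≠ 0) (hm : ∀ i j, m i ≤ m j → i = j) (i : Fin r)
    {κ : Type*} [Fintype κ] [Unique κ] {e : κ → Chain k r} (he : ∀ j, e j = Pi.single {i} 1) :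
    IsRelHomologyBasis m (m i) e := by
  have hmi : mdeg m {i} = m i := by simp [mdeg]
  have hlt : ∀ {A : Finset (Fin r)}, mdeg m A < m i ↔ A = ∅ := fun {A} => by
    constructor
    · intro h
      refine ((mdeg_le_gen_iff hm).1 h.le).resolve_right ?_
      rintro rfl
      exact h.ne hmi
    · rintro rfl
      exact lt_of_le_of_ne ((mdeg_le_gen_iff hm).2 (.inl rfl)) (hm0 i).symm
  have hd : ∀ x ∈ chainsLE k m (m i), boundary k r x ∈ chainsLT k m (m i) := fun x hx =>
    boundary_mem_chains (fun A hA j hj => by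
      rcases (mdeg_le_gen_iff hm).1 hA with rfl | rfl
      · simp at hj
      · refine hlt.2 ?_
        rw [Finset.mem_singleton.1 hj]
        simp) hx
  have hle : ∀ j, e j ∈ chainsLE k m (m i) := fun j => by
    rw [he]; exact single_mem_chains hmi.le _
  constructor
  · exact hle
  · exact fun j => hd _ (hle j)
  · intro c hc
    have h1 : ∑ j, c j • e j ∈ chainsLT k m (m i) := by
      refine (sup_le le_rfl ?_ : _ ≤ chainsLT k m (m i)) hc
      rintro _ ⟨y, hy, rfl⟩
      exact hd y hy
    intro j
    have := h1 {i} (by simp [hlt])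
    rw [Fintype.sum_unique, he] at this
    rw [Subsingleton.elim j default]
    simpa using this
  · intro x hx _
    refine ⟨fun _ => x {i}, Submodule.mem_sup_left fun A hA => ?_⟩
    rw [Fintype.sum_unique, he]
    by_cases hA1 : A = {i}
    · simp [hA1]
    · have : x A = 0 := hx A fun h => ((mdeg_le_gen_iff hm).1 h).elim (fun h => hA (hlt.2 h)) hA1
      simp [hA1, this]

theorem ne_zero_of_monomialIdeal_ne_top (h : monomialIdeal k m ≠ ⊤) (i : Fin r) : m i ≠ 0 := by
  intro h0
  refine h ((Ideal.eq_top_iff_one _).2 (Ideal.subset_span ⟨i, ?_⟩))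
  simp [h0]

theorem IsMinimalGenerators.eq_of_le (h : IsMinimalGenerators k m) (i j : Fin r)
    (hij : m i ≤ m j) : i = j := by
  by_contra hne
  refine h j ?_
  have : monomial (m j) (1 : k) = monomial (m j - m i) 1 * monomial (m i) 1 := by
    rw [monomial_mul, tsub_add_cancel_of_le hij, one_mul]
  rw [this]
  exact Ideal.mul_mem_left _ _ (Ideal.subset_span ⟨i, hne, rfl⟩)

theorem exists_gen_le {u : LcmLattice m} (hu : u ≠ LcmLattice.one m) : ∃ i, m i ≤ u.1 := by
  obtain ⟨u, A, rfl⟩ := u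
  obtain rfl | ⟨i, hi⟩ := A.eq_empty_or_nonempty
  · exact absurd (Subtype.ext (by simp [mdeg, LcmLattice.one, bot_eq_zero])) hu
  · exact ⟨i, Finset.le_sup (f := m) hi⟩

theorem two_le_rank (hm : ∀ i, m i ≠ 0) {u : LcmLattice m} (h1 : u ≠ LcmLattice.one m)
    (h2 : ∀ i, u ≠ LcmLattice.gen m i) : 2 ≤ rank m u := by
  obtain ⟨i, hi⟩ := exists_gen_le h1
  have hlt : LcmLattice.gen m i < u := lt_of_le_of_ne hi (h2 i).symm
  have hlt0 : LcmLattice.one m < LcmLattice.gen m i :=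
    lt_of_le_of_ne (Subtype.coe_le_coe.1 (zero_le : 0 ≤ m i))
      fun h => hm i (congrArg Subtype.val h).symm
  calc (2 : ℕ∞) = 0 + 1 + 1 := by norm_num
    _ ≤ Order.height (LcmLattice.one m) + 1 + 1 := by gcongr; exact zero_le
    _ ≤ Order.height (LcmLattice.gen m i) + 1 := by gcongr; exact Order.height_add_one_le hlt0
    _ ≤ Order.height u := Order.height_add_one_le hlt

end

section

variable {n r : ℕ} {k : Type*} [Field k]

/-! ### The part of the boundary map that preserves the multidegree -/

/-- The component of multidegree `u` of a chain. -/
def mdegProj (k : Type*) [Field k] (m : Fin r → (Fin n →₀ ℕ)) (u : Fin n →₀ ℕ) :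
    Chain k r →ₗ[k] Chain k r :=
  LinearMap.pi fun A => if mdeg m A = u then LinearMap.proj A else 0

/-- The part of the boundary map that preserves the multidegree. -/
def mdegBoundary (k : Type*) [Field k] (m : Fin r → (Fin n →₀ ℕ)) : Chain k r →ₗ[k] Chain k r :=
  Fintype.linearCombination k fun A => mdegProj k m (mdeg m A) (faceBoundary k A)

variable {m : Fin r → (Fin n →₀ ℕ)}

theorem mdegProj_apply (u : Fin n →₀ ℕ) (x : Chain k r) (A : Finset (Fin r)) :
    mdegProj k m u x A = if mdeg m A = u then x A else 0 := by
  rw [mdegProj, LinearMap.pi_apply]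
  split_ifs <;> rfl

theorem mdegProj_single (u : Fin n →₀ ℕ) (A : Finset (Fin r)) (c : k) :
    mdegProj k m u (Pi.single A c) = if mdeg m A = u then Pi.single A c else 0 := by
  ext B
  rw [mdegProj_apply]
  by_cases hB : B = A
  · subst hB; split_ifs <;> rfl
  · split_ifs <;> simp [hB]

theorem mdegBoundary_single (A : Finset (Fin r)) :
    mdegBoundary k m (Pi.single A 1) = mdegProj k m (mdeg m A) (faceBoundary k A) := by
  simp [mdegBoundary]

theorem mdegProj_eq_zero_of_lt {u : Fin n →₀ ℕ} {x : Chain k r} (hx : x ∈ chainsLT k m u) :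
    mdegProj k m u x = 0 := by
  ext A
  rw [mdegProj_apply]
  split_ifs with h
  · exact hx A fun h' => h'.ne h
  · rfl

theorem mdegProj_eq_zero_of_not_le {u v : Fin n →₀ ℕ} (h : ¬ u ≤ v) {x : Chain k r}
    (hx : x ∈ chainsLE k m v) : mdegProj k m u x = 0 := by
  ext A
  rw [mdegProj_apply]
  split_ifs with hA
  · exact hx A fun h' => h (hA ▸ h')
  · rfl

theorem mem_chainsLT_of_mdegProj {u : Fin n →₀ ℕ} {x : Chain k r} (hx : x ∈ chainsLE k m u)
    (h : mdegProj k m u x = 0) : x ∈ chainsLT k m u := by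
  intro A hA
  by_cases hu : mdeg m A = u
  · simpa [mdegProj_apply, hu] using congrFun h A
  · exact hx A fun h' => hA (lt_of_le_of_ne h' hu)

/-- Faces of multidegree strictly below `u` have no boundary term in multidegree `u`, so modulo the
lower filtration step the boundary acts as `mdegBoundary`. -/
theorem mdegProj_boundary {u : Fin n →₀ ℕ} {x : Chain k r} (hx : x ∈ chainsLE k m u) :
    mdegProj k m u (boundary k r x) = mdegBoundary k m (mdegProj k m u x) := by
  rw [← sub_eq_zero]
  refine mem_of_single_mem (S := LinearMap.ker
    (mdegProj k m u ∘ₗ boundary k r - mdegBoundary k m ∘ₗ mdegProj k m u)) (fun A hA => ?_) hx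
  simp only [LinearMap.mem_ker, LinearMap.sub_apply, LinearMap.comp_apply, mdegProj_single,
    sub_eq_zero]
  split_ifs with h
  · rw [boundary_single, mdegBoundary_single, h]
  · rw [map_zero]
    refine mdegProj_eq_zero_of_lt (boundary_mem_chainsLT (single_mem_chains ?_ _))
    exact lt_of_le_of_ne hA h

theorem mdegProj_mdegProj (u v : Fin n →₀ ℕ) (x : Chain k r) :
    mdegProj k m u (mdegProj k m v x) = if v = u then mdegProj k m u x else 0 := by
  ext A
  by_cases h : v = u
  · subst h; simp only [mdegProj_apply, if_true]; split_ifs <;> rfl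
  · simp only [mdegProj_apply, if_neg h]
    split_ifs with h1 h2
    · exact absurd (h2.symm.trans h1) h
    all_goals rfl

theorem mdegProj_mdegBoundary (u : Fin n →₀ ℕ) (x : Chain k r) :
    mdegProj k m u (mdegBoundary k m x) = mdegBoundary k m (mdegProj k m u x) := by
  rw [← sub_eq_zero]
  refine mem_of_single_mem (Δ := Set.univ) (S := LinearMap.ker
    (mdegProj k m u ∘ₗ mdegBoundary k m - mdegBoundary k m ∘ₗ mdegProj k m u)) (fun A _ => ?_)
    (fun A hA => by simp at hA)
  simp only [LinearMap.mem_ker, LinearMap.sub_apply, LinearMap.comp_apply, mdegProj_single,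
    sub_eq_zero, mdegBoundary_single, mdegProj_mdegProj]
  split_ifs with h
  · rw [mdegBoundary_single, h]
  · simp

theorem single_mem_chainsLE (A : Finset (Fin r)) (c : k) :
    (Pi.single A c : Chain k r) ∈ chainsLE k m (mdeg m A) :=
  single_mem_chains (le_refl (mdeg m A)) c

theorem mdegBoundary_mdegBoundary (x : Chain k r) : mdegBoundary k m (mdegBoundary k m x) = 0 := by
  refine mem_of_single_mem (Δ := Set.univ)
    (S := LinearMap.ker (mdegBoundary k m ∘ₗ mdegBoundary k m)) (fun A _ => ?_)
    (fun A hA => by simp at hA)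
  rw [LinearMap.mem_ker, LinearMap.comp_apply, mdegBoundary_single, ← boundary_single,
    ← mdegProj_boundary (boundary_mem_chainsLE (single_mem_chainsLE A 1)), boundary_boundary,
    map_zero]

/-! ### A basis of the chains adapted to the multidegrees -/

section AdaptedBasis

variable {t : LcmLattice m → ℕ} {κ : Type}

/-- The index set of the adapted basis. -/
abbrev AdaptedIndex (t : LcmLattice m → ℕ) (κ : Type) : Type :=
  ((u : LcmLattice m) × Fin (t u)) ⊕ (κ ⊕ κ)

/-- The adapted family: the chains `e u j`, the faces `a x`, and their boundaries. -/
def adaptedFamily (e : ∀ u : LcmLattice m, Fin (t u) → Chain k r) (a : κ → Finset (Fin r)) :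
    AdaptedIndex t κ → Chain k r :=
  Sum.elim (fun b => e b.1 b.2)
    (Sum.elim (fun x => Pi.single (a x) 1) fun x => boundary k r (Pi.single (a x) 1))

/-- The multidegrees of the adapted family. -/
def adaptedMdeg (t : LcmLattice m → ℕ) (a : κ → Finset (Fin r)) :
    AdaptedIndex t κ → (Fin n →₀ ℕ) :=
  Sum.elim (fun b => b.1.1) (Sum.elim (fun x => mdeg m (a x)) fun x => mdeg m (a x))

/-- The homological degrees of the adapted family. -/
def adaptedDegree (δ : ∀ u : LcmLattice m, Fin (t u) → ℕ) (a : κ → Finset (Fin r)) :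
    AdaptedIndex t κ → ℕ :=
  Sum.elim (fun b => δ b.1 b.2) (Sum.elim (fun x => (a x).card) fun x => (a x).card - 1)

/-- The faces `a x` are chosen such that the multidegree preserving parts of their boundaries
form a basis of all such. -/
structure IsBoundaryBasis (k : Type*) [Field k] (m : Fin r → (Fin n →₀ ℕ))
    (a : κ → Finset (Fin r)) : Prop where
  indep : LinearIndependent k fun x => mdegBoundary k m (Pi.single (a x) 1)
  span : Submodule.span k (Set.range fun x => mdegBoundary k m (Pi.single (a x) 1)) =
    LinearMap.range (mdegBoundary k m)

/-- The images of single faces span the range, so a basis can be extracted from them. Using faces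
rather than arbitrary chains gives each chosen element a definite multidegree and cardinality. -/
theorem exists_isBoundaryBasis (k : Type*) [Field k] (m : Fin r → (Fin n →₀ ℕ)) :
    ∃ (κ : Type) (_ : Fintype κ) (a : κ → Finset (Fin r)), IsBoundaryBasis k m a := by
  obtain ⟨κ, a, ha, hspan, hind⟩ := exists_linearIndependent' k
    fun A : Finset (Fin r) => mdegBoundary k m (Pi.single A 1)
  refine ⟨κ, Fintype.ofInjective a ha, a, hind, ?_⟩
  refine Eq.trans hspan ?_
  refine le_antisymm (Submodule.span_le.2 ?_) ?_
  · rintro _ ⟨A, rfl⟩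
    exact ⟨_, rfl⟩
  · rintro _ ⟨x, rfl⟩
    refine mem_of_single_mem (Δ := Set.univ) (S := (Submodule.span k _).comap (mdegBoundary k m))
      (fun A _ => ?_) (fun A hA => by simp at hA)
    exact Submodule.subset_span ⟨A, rfl⟩

variable {e : ∀ u : LcmLattice m, Fin (t u) → Chain k r} {a : κ → Finset (Fin r)}

theorem adaptedFamily_mem (he : ∀ u, IsRelHomologyBasis m u.1 (e u)) (b : AdaptedIndex t κ) :
    adaptedFamily e a b ∈ chainsLE k m (adaptedMdeg t a b) := by
  rcases b with b | x | x
  · exact (he b.1).mem b.2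
  · exact single_mem_chainsLE _ _
  · exact boundary_mem_chainsLE (single_mem_chainsLE _ _)

variable [Fintype κ]

/-- Since `mdegBoundary` preserves multidegrees, projecting an expansion to multidegree `u` discards
every face of another multidegree. -/
theorem IsBoundaryBasis.exists_coeff (ha : IsBoundaryBasis k m a) (u : Fin n →₀ ℕ) (y : Chain k r) :
    ∃ c : κ → k, (∀ x, c x ≠ 0 → mdeg m (a x) = u) ∧
      mdegBoundary k m (mdegProj k m u y) =
        ∑ x, c x • mdegBoundary k m (Pi.single (a x) 1) := by
  have h : mdegBoundary k m y ∈ LinearMap.range (mdegBoundary k m) := ⟨y, rfl⟩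
  rw [← ha.span] at h
  obtain ⟨c, hc⟩ := (Submodule.mem_span_range_iff_exists_fun k).1 h
  refine ⟨fun x => if mdeg m (a x) = u then c x else 0, fun x hx => by
    by_contra h; simp [h] at hx, ?_⟩
  rw [← mdegProj_mdegBoundary, ← hc, map_sum]
  refine Finset.sum_congr rfl fun x _ => ?_
  rw [map_smul, mdegProj_mdegBoundary, mdegProj_single]
  dsimp only
  split_ifs <;> simp

/-- Cancelling the leading part of the boundary turns `y` into a relative cycle of `(Ω_u, Δ_u)`. -/
theorem sum_sub_mem_chainsLT (u : Fin n →₀ ℕ) {c : κ → k}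
    (hc : ∀ x, c x ≠ 0 → mdeg m (a x) = u) {y : Chain k r} (hy : y ∈ chainsLE k m u)
    (h : mdegBoundary k m (mdegProj k m u y) =
      ∑ x, c x • mdegBoundary k m (Pi.single (a x) 1)) :
    boundary k r (y - ∑ x, c x • Pi.single (a x) 1) ∈ chainsLT k m u := by
  have h1 : ∀ x, mdegProj k m u (c x • Pi.single (a x) 1) = c x • Pi.single (a x) 1 := by
    intro x
    by_cases hx : c x = 0
    · simp [hx]
    · rw [map_smul, mdegProj_single, if_pos (hc x hx)]
  have h2 : y - ∑ x, c x • Pi.single (a x) 1 ∈ chainsLE k m u := by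
    refine Submodule.sub_mem _ hy (Submodule.sum_mem _ fun x _ => ?_)
    by_cases hx : c x = 0
    · simp [hx]
    · rw [← hc x hx]
      exact Submodule.smul_mem _ _ (single_mem_chainsLE _ _)
  refine mem_chainsLT_of_mdegProj (boundary_mem_chainsLE h2) ?_
  rw [mdegProj_boundary h2, map_sub, map_sub, h, map_sum, map_sum, sub_eq_zero]
  exact Finset.sum_congr rfl fun x _ => by rw [h1, map_smul]

/-- Induction up the lattice. Modulo the faces `a x`, a chain of `Ω_u` is a relative cycle, so it is
a combination of the `e u j`, a lower chain and a boundary; modulo the boundaries of the `a x`, that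
boundary is lower too. -/
theorem chainsLE_le_span (he : ∀ u, IsRelHomologyBasis m u.1 (e u)) (ha : IsBoundaryBasis k m a)
    (u : LcmLattice m) :
    chainsLE k m u.1 ≤ Submodule.span k (adaptedFamily e a '' {b | adaptedMdeg t a b ≤ u.1}) := by
  induction u using WellFoundedLT.induction with
  | ind u ih =>
  set S := Submodule.span k (adaptedFamily e a '' {b | adaptedMdeg t a b ≤ u.1}) with hS
  have hlt : chainsLT k m u.1 ≤ S := fun x hx => by
    refine mem_of_single_mem (fun A hA => ?_) hx
    have := ih ⟨mdeg m A, A, rfl⟩ hA (single_mem_chainsLE A 1)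
    refine Submodule.span_mono (Set.image_mono fun b hb => ?_) this
    exact le_trans hb (show mdeg m A < u.1 from hA).le
  have hgen : ∀ b, adaptedMdeg t a b ≤ u.1 → adaptedFamily e a b ∈ S := fun b hb =>
    Submodule.subset_span ⟨b, hb, rfl⟩
  have hd : ∀ y ∈ chainsLE k m u.1, boundary k r y ∈ S := by
    intro y hy
    obtain ⟨c, hc, hyc⟩ := ha.exists_coeff u.1 y
    have h1 := hlt (sum_sub_mem_chainsLT u.1 hc hy hyc)
    rw [map_sub, map_sum] at h1
    refine (Submodule.sub_mem_iff_left _ (Submodule.sum_mem _ fun x _ => ?_)).1 h1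
    by_cases hx : c x = 0
    · simp [hx]
    · rw [map_smul]
      exact S.smul_mem _ (hgen (.inr (.inr x)) (hc x hx).le)
  intro x hx
  obtain ⟨c, hc, hxc⟩ := ha.exists_coeff u.1 x
  have h1 := sum_sub_mem_chainsLT u.1 hc hx hxc
  have h2 : ∑ x, c x • (Pi.single (a x) 1 : Chain k r) ∈ S ⊓ chainsLE k m u.1 := by
    refine Submodule.sum_mem _ fun x _ => ?_
    by_cases hx : c x = 0
    · simp [hx]
    · refine Submodule.smul_mem _ _ ⟨hgen (.inr (.inl x)) (hc x hx).le, ?_⟩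
      rw [← hc x hx]
      exact single_mem_chainsLE _ _
  obtain ⟨c', hc'⟩ := (he u).span _ (Submodule.sub_mem _ hx h2.2) h1
  have h3 : chainsLT k m u.1 ⊔ (chainsLE k m u.1).map (boundary k r) ≤ S := by
    refine sup_le hlt ?_
    rintro _ ⟨y, hy, rfl⟩
    exact hd y hy
  rw [← Submodule.sub_mem_iff_left S h2.1, ← Submodule.sub_mem_iff_left S (y := ∑ j, c' j • e u j)
    (S.sum_mem fun j _ => S.smul_mem _ (hgen (.inl ⟨u, j⟩) le_rfl))]
  exact h3 hc'

/-- Induction down the lattice: project a relation to multidegree `u`. Labels not above `u`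
contribute nothing, labels strictly above `u` have zero coefficients already, and the three kinds of
elements at `u` are then separated one after another. -/
theorem linearIndependent_adaptedFamily (he : ∀ u, IsRelHomologyBasis m u.1 (e u))
    (ha : IsBoundaryBasis k m a) : LinearIndependent k (adaptedFamily e a) := by
  rw [Fintype.linearIndependent_iff]
  intro g hg
  simp only [Fintype.sum_sum_type, Fintype.sum_sigma, adaptedFamily, Sum.elim_inl,
    Sum.elim_inr] at hg
  have key : ∀ u : LcmLattice m, (∀ j, g (.inl ⟨u, j⟩) = 0) ∧ ∀ x, mdeg m (a x) = u.1 →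
      g (.inr (.inl x)) = 0 ∧ g (.inr (.inr x)) = 0 := by
    intro u
    induction u using WellFoundedGT.induction with
    | ind u ih =>
    have hg' := congrArg (mdegProj k m u.1) hg
    simp only [map_add, map_sum, map_smul, map_zero] at hg'
    set c : κ → k := fun x => if mdeg m (a x) = u.1 then g (.inr (.inl x)) else 0 with hc
    set c' : κ → k := fun x => if mdeg m (a x) = u.1 then g (.inr (.inr x)) else 0 with hc'
    have hc'u : ∀ x, c' x ≠ 0 → mdeg m (a x) = u.1 := fun x hx => by
      by_contra h; simp [hc', h] at hx
    have h1 : ∑ v : LcmLattice m, ∑ j, g (.inl ⟨v, j⟩) • mdegProj k m u.1 (e v j) =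
        mdegProj k m u.1 (∑ j, g (.inl ⟨u, j⟩) • e u j) := by
      rw [Finset.sum_eq_single_of_mem u (Finset.mem_univ u)]
      · simp
      · intro v _ hv
        refine Finset.sum_eq_zero fun j _ => ?_
        by_cases huv : u.1 ≤ v.1
        · rw [(ih v (lt_of_le_of_ne huv hv.symm)).1 j, zero_smul]
        · rw [mdegProj_eq_zero_of_not_le huv ((he v).mem j), smul_zero]
    have h2 : ∀ x, g (.inr (.inl x)) • mdegProj k m u.1 (Pi.single (a x) 1) =
        c x • (Pi.single (a x) 1 : Chain k r) := by
      intro x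
      rw [mdegProj_single, hc]
      dsimp only
      split_ifs <;> simp
    have h3 : ∀ x, g (.inr (.inr x)) • mdegProj k m u.1 (boundary k r (Pi.single (a x) 1)) =
        c' x • mdegBoundary k m (Pi.single (a x) 1) := by
      intro x
      by_cases hx : mdeg m (a x) = u.1
      · rw [mdegBoundary_single, boundary_single, hc']
        simp [hx]
      · rw [hc']
        simp only [hx, if_false, zero_smul]
        by_cases hux : u.1 ≤ mdeg m (a x)
        · rw [((ih ⟨mdeg m (a x), a x, rfl⟩ (lt_of_le_of_ne hux fun h => hx (congrArg Subtype.val h).symm)).2 x rfl).2,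
            zero_smul]
        · rw [mdegProj_eq_zero_of_not_le hux (boundary_mem_chainsLE (single_mem_chainsLE _ _)),
            smul_zero]
    simp only [h1, h2, h3] at hg'
    have hmemE : ∑ j, g (.inl ⟨u, j⟩) • e u j ∈ chainsLE k m u.1 :=
      Submodule.sum_mem _ fun j _ => Submodule.smul_mem _ _ ((he u).mem j)
    have hE : mdegBoundary k m (mdegProj k m u.1 (∑ j, g (.inl ⟨u, j⟩) • e u j)) = 0 := by
      rw [← mdegProj_boundary hmemE, map_sum]
      exact mdegProj_eq_zero_of_lt (Submodule.sum_mem _ fun j _ => by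
        rw [map_smul]; exact Submodule.smul_mem _ _ ((he u).boundary_mem j))
    -- Applying `mdegBoundary` to the projected relation kills the relative cycles and the
    -- boundaries, leaving only the faces `a x`.
    have hc0 : ∀ x, c x = 0 := by
      refine Fintype.linearIndependent_iff.1 ha.indep c ?_
      have := congrArg (mdegBoundary k m) hg'
      rw [map_add, map_add, hE, zero_add, map_zero, map_sum, map_sum] at this
      simpa [mdegBoundary_mdegBoundary] using this
    simp only [hc0, zero_smul, Finset.sum_const_zero, zero_add] at hg'
    have hmemC : ∀ x, c' x • (Pi.single (a x) 1 : Chain k r) ∈ chainsLE k m u.1 := by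
      intro x
      by_cases hx : c' x = 0
      · simp [hx]
      · rw [← hc'u x hx]
        exact Submodule.smul_mem _ _ (single_mem_chainsLE _ _)
    have hproj : ∀ x, c' x • mdegBoundary k m (Pi.single (a x) 1) =
        mdegProj k m u.1 (boundary k r (c' x • Pi.single (a x) 1)) := by
      intro x
      by_cases hx : c' x = 0
      · simp [hx]
      · rw [map_smul, map_smul, boundary_single, mdegBoundary_single, hc'u x hx]
    -- The remaining relation puts the combination of the `e u j` into the sum of lower chains and
    -- boundaries, so its relative homology class is zero.
    have hg0 : ∀ j, g (.inl ⟨u, j⟩) = 0 := by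
      refine (he u).indep _ (Submodule.mem_sup.2 ⟨_, mem_chainsLT_of_mdegProj
        (x := ∑ j, g (.inl ⟨u, j⟩) • e u j +
          boundary k r (∑ x, c' x • (Pi.single (a x) 1 : Chain k r))) ?_ ?_,
        _, ⟨-∑ x, c' x • (Pi.single (a x) 1 : Chain k r), ?_, rfl⟩, ?_⟩)
      · exact Submodule.add_mem _ hmemE
          (boundary_mem_chainsLE (Submodule.sum_mem _ fun x _ => hmemC x))
      · rw [map_add, map_sum (boundary k r), map_sum (mdegProj k m u.1) _ (Finset.univ : Finset κ)]
        simpa only [hproj] using hg'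
      · exact Submodule.neg_mem _ (Submodule.sum_mem _ fun x _ => hmemC x)
      · rw [map_neg]; abel
    refine ⟨hg0, fun x hx => ⟨by simpa [hc, hx] using hc0 x, ?_⟩⟩
    have hc'0 : ∀ x, c' x = 0 := by
      refine Fintype.linearIndependent_iff.1 ha.indep c' ?_
      simpa [hg0] using hg'
    simpa [hc', hx] using hc'0 x
  rintro (⟨u, j⟩ | x | x)
  · exact (key u).1 j
  · exact ((key ⟨mdeg m (a x), a x, rfl⟩).2 x rfl).1
  · exact ((key ⟨mdeg m (a x), a x, rfl⟩).2 x rfl).2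

/-- The adapted basis of the space of chains. -/
def adaptedBasis (he : ∀ u, IsRelHomologyBasis m u.1 (e u)) (ha : IsBoundaryBasis k m a) :
    Module.Basis (AdaptedIndex t κ) k (Chain k r) :=
  .mk (linearIndependent_adaptedFamily he ha) fun x _ =>
    mem_of_single_mem (Δ := Set.univ) (fun A _ => Submodule.span_mono (Set.image_subset_range _ _)
      (chainsLE_le_span he ha ⟨mdeg m A, A, rfl⟩ (single_mem_chainsLE A 1)))
      (fun A hA => by simp at hA)

theorem adaptedBasis_apply (he : ∀ u, IsRelHomologyBasis m u.1 (e u)) (ha : IsBoundaryBasis k m a)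
    (b : AdaptedIndex t κ) : adaptedBasis he ha b = adaptedFamily e a b := by
  simp [adaptedBasis]

end AdaptedBasis

end

section

variable {n r : ℕ} {k : Type*} [Field k]

/-! ### Homogeneous coordinates and the hypotheses on the chains -/

theorem eq_zero_of_mem_chains_compl {Δ : Set (Finset (Fin r))} {x : Chain k r}
    (h : x ∈ chains k Δ) (h' : x ∈ chains k Δᶜ) : x = 0 := by
  ext A
  by_cases hA : A ∈ Δ
  · exact h' A (by simpa using hA)
  · exact h A hA

theorem repr_eq_zero_of_homogeneous {ι : Type*} [Fintype ι] (N : Module.Basis ι k (Chain k r))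
    {deg : ι → ℕ} (hN : ∀ b, N b ∈ chains k {A : Finset (Fin r) | A.card = deg b}) {i : ℕ}
    {x : Chain k r} (hx : x ∈ chains k {A : Finset (Fin r) | A.card = i}) {b : ι}
    (hb : deg b ≠ i) : N.repr x b = 0 := by
  classical
  have h1 := N.sum_repr x
  rw [← Finset.sum_filter_add_sum_filter_not Finset.univ (fun b => deg b = i)] at h1
  -- The part in other degrees is supported both on faces of cardinality `i` and off them.
  have h2 : ∑ b ∈ Finset.univ.filter (fun b => ¬ deg b = i), N.repr x b • N b = 0 := by
    refine eq_zero_of_mem_chains_compl (Δ := {A : Finset (Fin r) | A.card = i}) ?_ ?_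
    · rw [eq_sub_of_add_eq' h1]
      refine Submodule.sub_mem _ hx (Submodule.sum_mem _ fun b hb => Submodule.smul_mem _ _ ?_)
      have := hN b
      rwa [(Finset.mem_filter.1 hb).2] at this
    · refine Submodule.sum_mem _ fun b hb => Submodule.smul_mem _ _ ?_
      refine chains_mono (fun A hA => ?_) (hN b)
      intro hA'
      exact (Finset.mem_filter.1 hb).2 (Eq.trans (Eq.symm hA) hA')
  exact linearIndependent_iff'.1 N.linearIndependent _ _ h2 b (by simp [hb])

/-- The conditions on a family of chains `e u j` in homological degrees `δ u j` under which its
boundaries define a frame. -/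
structure IsFrameFamily (m : Fin r → (Fin n →₀ ℕ)) {t : LcmLattice m → ℕ}
    (e : ∀ u : LcmLattice m, Fin (t u) → Chain k r) (δ : ∀ u : LcmLattice m, Fin (t u) → ℕ) :
    Prop where
  ne_zero : ∀ i, m i ≠ 0
  eq_of_le : ∀ i j, m i ≤ m j → i = j
  card : ∀ u j, e u j ∈ chains k {A : Finset (Fin r) | A.card = δ u j}
  one : t (LcmLattice.one m) = 1 ∧ ∀ j, e (LcmLattice.one m) j = Pi.single ∅ 1
  gen : ∀ i, t (LcmLattice.gen m i) = 1 ∧ ∀ j, e (LcmLattice.gen m i) j = Pi.single {i} 1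
  rel : ∀ u, IsRelHomologyBasis m u.1 (e u)
  comb : ∀ u j, boundary k r (e u j) ∈ Submodule.span k {c | ∃ v, v < u ∧ ∃ i, c = e v i}

variable {m : Fin r → (Fin n →₀ ℕ)} {t : LcmLattice m → ℕ}
  {e : ∀ u : LcmLattice m, Fin (t u) → Chain k r} {δ : ∀ u : LcmLattice m, Fin (t u) → ℕ}

namespace IsFrameFamily

/-! ### Homological degrees zero and one -/

theorem not_mem_sup (h : IsFrameFamily m e δ) (u : LcmLattice m) (j : Fin (t u)) :
    e u j ∉ chainsLT k m u.1 ⊔ (chainsLE k m u.1).map (boundary k r) := by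
  intro hj
  have := (h.rel u).indep (Pi.single j 1) (by simpa [Pi.single_apply] using hj) j
  simp at this

theorem mem_of_apply_ne_zero {Δ : Set (Finset (Fin r))} {x : Chain k r} (hx : x ∈ chains k Δ)
    {A : Finset (Fin r)} (hA : x A ≠ 0) : A ∈ Δ := by
  by_contra h
  exact hA (hx A h)

/-- Were every face of that cardinality of multidegree different from `u`, the chain would lie in
`Δ_u` and have zero relative class. This ties homological degrees 0 and 1 to the labels `1` and
`m_i`. -/
theorem eq_mdeg_of_card (h : IsFrameFamily m e δ) (u : LcmLattice m) (j : Fin (t u)) :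
    ∃ A : Finset (Fin r), A.card = δ u j ∧ mdeg m A = u.1 := by
  by_contra! hA
  refine h.not_mem_sup u j (Submodule.mem_sup_left fun A hA' => ?_)
  by_contra h0
  have h1 : A.card = δ u j := mem_of_apply_ne_zero (h.card u j) h0
  have h2 : mdeg m A ≤ u.1 := mem_of_apply_ne_zero ((h.rel u).mem j) h0
  exact hA' (lt_of_le_of_ne h2 (hA A h1))

theorem eq_one_of_degree (h : IsFrameFamily m e δ) {u : LcmLattice m} {j : Fin (t u)}
    (hj : δ u j = 0) : u = LcmLattice.one m := by
  obtain ⟨A, hA, hu⟩ := h.eq_mdeg_of_card u j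
  rw [hj, Finset.card_eq_zero] at hA
  subst hA
  exact Subtype.ext hu.symm

theorem eq_gen_of_degree (h : IsFrameFamily m e δ) {u : LcmLattice m} {j : Fin (t u)}
    (hj : δ u j = 1) : ∃ i, u = LcmLattice.gen m i := by
  obtain ⟨A, hA, hu⟩ := h.eq_mdeg_of_card u j
  rw [hj, Finset.card_eq_one] at hA
  obtain ⟨i, rfl⟩ := hA
  exact ⟨i, Subtype.ext (by rw [← hu]; simp [mdeg, LcmLattice.gen])⟩

theorem degree_one (h : IsFrameFamily m e δ) (j : Fin (t (LcmLattice.one m))) :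
    δ (LcmLattice.one m) j = 0 := by
  have := h.card (LcmLattice.one m) j
  rw [h.one.2] at this
  exact (mem_of_apply_ne_zero this (A := ∅) (by simp)).symm

theorem degree_gen (h : IsFrameFamily m e δ) (i : Fin r) (j : Fin (t (LcmLattice.gen m i))) :
    δ (LcmLattice.gen m i) j = 1 := by
  have := h.card (LcmLattice.gen m i) j
  rw [(h.gen i).2] at this
  exact (mem_of_apply_ne_zero this (A := {i}) (by simp)).symm

/-! ### Coordinates with respect to the adapted basis -/

variable {κ : Type} {a : κ → Finset (Fin r)}

theorem adaptedFamily_mem_card (h : IsFrameFamily m e δ) (b : AdaptedIndex t κ) :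
    adaptedFamily e a b ∈ chains k {A : Finset (Fin r) | A.card = adaptedDegree δ a b} := by
  rcases b with b | x | x
  · exact h.card b.1 b.2
  · exact single_mem_chains (k := k) (Δ := {A | A.card = (a x).card}) rfl 1
  · change boundary k r (Pi.single (a x) 1) ∈ chains k {A : Finset (Fin r) | A.card = (a x).card - 1}
    rw [boundary_single]
    exact faceBoundary_mem_chains fun i hi => Finset.card_erase_of_mem hi

variable [Fintype κ]

theorem adaptedBasis_inl (h : IsFrameFamily m e δ) (ha : IsBoundaryBasis k m a)
    (b : (u : LcmLattice m) × Fin (t u)) : adaptedBasis h.rel ha (.inl b) = e b.1 b.2 :=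
  adaptedBasis_apply h.rel ha _

theorem repr_of_degree_ne (h : IsFrameFamily m e δ) (ha : IsBoundaryBasis k m a) {i : ℕ}
    {x : Chain k r} (hx : x ∈ chains k {A : Finset (Fin r) | A.card = i}) {b : AdaptedIndex t κ}
    (hb : adaptedDegree δ a b ≠ i) : (adaptedBasis h.rel ha).repr x b = 0 :=
  repr_eq_zero_of_homogeneous _ (fun b => by
    rw [adaptedBasis_apply]; exact h.adaptedFamily_mem_card b) hx hb

/-- Compatibility of the adapted basis with the filtration, in terms of coordinates; it later shows
that the inverse change-of-basis matrix can be homogenized. -/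
theorem mdeg_le_of_repr_ne_zero (h : IsFrameFamily m e δ) (ha : IsBoundaryBasis k m a)
    {w : Fin n →₀ ℕ} {x : Chain k r} (hx : x ∈ chainsLE k m w) {b : AdaptedIndex t κ}
    (hb : (adaptedBasis h.rel ha).repr x b ≠ 0) : adaptedMdeg t a b ≤ w := by
  have h1 : x ∈ Submodule.span k (adaptedBasis h.rel ha '' {b | adaptedMdeg t a b ≤ w}) := by
    refine mem_of_single_mem (fun A hA => ?_) hx
    have := chainsLE_le_span h.rel ha ⟨mdeg m A, A, rfl⟩ (single_mem_chainsLE A 1)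
    rw [show ⇑(adaptedBasis h.rel ha) = adaptedFamily e a from funext (adaptedBasis_apply h.rel ha)]
    refine Submodule.span_mono (Set.image_mono ?_) this
    intro b hb
    exact (show adaptedMdeg t a b ≤ mdeg m A from hb).trans hA
  exact (adaptedBasis h.rel ha).repr_support_subset_of_mem_span _ h1 (Finsupp.mem_support_iff.2 hb)

/-- Here the hypothesis on the boundaries enters: no trivial basis element occurs, and labels
strictly decrease. -/
theorem repr_boundary_ne_zero (h : IsFrameFamily m e δ) (ha : IsBoundaryBasis k m a)
    {b : (u : LcmLattice m) × Fin (t u)} {c : AdaptedIndex t κ}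
    (hc : (adaptedBasis h.rel ha).repr (boundary k r (e b.1 b.2)) c ≠ 0) :
    ∃ b' : (u : LcmLattice m) × Fin (t u), c = .inl b' ∧ b'.1 < b.1 := by
  have h1 : boundary k r (e b.1 b.2) ∈ Submodule.span k (adaptedBasis h.rel ha ''
      {c | ∃ b' : (u : LcmLattice m) × Fin (t u), c = .inl b' ∧ b'.1 < b.1}) := by
    refine Submodule.span_mono ?_ (h.comb b.1 b.2)
    rintro _ ⟨v, hv, i, rfl⟩
    exact ⟨.inl ⟨v, i⟩, ⟨_, rfl, hv⟩, adaptedBasis_apply _ _ _⟩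
  exact (adaptedBasis h.rel ha).repr_support_subset_of_mem_span _ h1 (Finsupp.mem_support_iff.2 hc)

theorem linearIndependent (h : IsFrameFamily m e δ) :
    LinearIndependent k fun b : (u : LcmLattice m) × Fin (t u) => e b.1 b.2 := by
  obtain ⟨κ, _, a, ha⟩ := exists_isBoundaryBasis k m
  exact (linearIndependent_adaptedFamily h.rel ha).comp _ Sum.inl_injective

theorem boundary_eq_sum (h : IsFrameFamily m e δ) (ha : IsBoundaryBasis k m a) {i : ℕ}
    {b : (u : LcmLattice m) × Fin (t u)} (hb : δ b.1 b.2 = i + 1) :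
    boundary k r (e b.1 b.2) = ∑ c : {c : (u : LcmLattice m) × Fin (t u) // δ c.1 c.2 = i},
      (adaptedBasis h.rel ha).repr (boundary k r (e b.1 b.2)) (.inl c.1) • e c.1.1 c.1.2 := by
  have hcard : boundary k r (e b.1 b.2) ∈ chains k {A : Finset (Fin r) | A.card = i} :=
    boundary_mem_card (by have := h.card b.1 b.2; rwa [hb] at this)
  conv_lhs => rw [← (adaptedBasis h.rel ha).sum_repr (boundary k r (e b.1 b.2))]
  rw [Fintype.sum_sum_type, Fintype.sum_eq_zero (fun c => _ • adaptedBasis h.rel ha (.inr c)),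
    add_zero]
  · rw [← Finset.sum_subset (Finset.subset_univ
      (Finset.univ.filter fun c : (u : LcmLattice m) × Fin (t u) => δ c.1 c.2 = i)),
      Finset.sum_subtype (p := fun c : (u : LcmLattice m) × Fin (t u) => δ c.1 c.2 = i) _
        (by simp)]
    · simp only [adaptedBasis_apply]
      rfl
    · intro c _ hc
      rw [h.repr_of_degree_ne ha hcard (by simpa [adaptedDegree] using hc), zero_smul]
  · intro c
    by_cases hc : (adaptedBasis h.rel ha).repr (boundary k r (e b.1 b.2)) (.inr c) = 0
    · rw [hc, zero_smul]
    · obtain ⟨_, h1, _⟩ := h.repr_boundary_ne_zero ha hc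
      cases h1

/-! ### The frame -/

theorem nonempty_unique_degree_zero (h : IsFrameFamily m e δ) :
    Nonempty (Unique {b : (u : LcmLattice m) × Fin (t u) // δ b.1 b.2 = 0}) := by
  have hs : Subsingleton (Fin (t (LcmLattice.one m))) := by rw [h.one.1]; infer_instance
  refine ⟨⟨⟨⟨⟨LcmLattice.one m, ⟨0, by rw [h.one.1]; exact one_pos⟩⟩, h.degree_one _⟩⟩, ?_⟩⟩
  rintro ⟨⟨u, j⟩, hj⟩
  obtain rfl := h.eq_one_of_degree hj
  exact Subtype.ext (congrArg (Sigma.mk _) (Subsingleton.elim _ _))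

theorem exists_vertex_equiv (h : IsFrameFamily m e δ) :
    ∃ φ : Fin r ≃ {b : (u : LcmLattice m) × Fin (t u) // δ b.1 b.2 = 1},
      ∀ i, e (φ i).1.1 (φ i).1.2 = Pi.single {i} 1 := by
  have hs : ∀ i, Subsingleton (Fin (t (LcmLattice.gen m i))) := fun i => by
    rw [(h.gen i).1]; infer_instance
  refine ⟨.ofBijective (fun i => ⟨⟨LcmLattice.gen m i, ⟨0, by rw [(h.gen i).1]; exact one_pos⟩⟩,
    h.degree_gen i _⟩) ⟨?_, ?_⟩, fun i => (h.gen i).2 _⟩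
  · intro i j hij
    have h1 := congrArg (fun b => b.1.1.1) hij
    exact h.eq_of_le i j (le_of_eq h1)
  · rintro ⟨⟨u, j⟩, hj⟩
    obtain ⟨i, rfl⟩ := h.eq_gen_of_degree hj
    exact ⟨i, Subtype.ext (congrArg (Sigma.mk _) (Subsingleton.elim _ _))⟩

theorem exists_frame (h : IsFrameFamily m e δ) :
    ∃ (V : Frame k r) (φ : ∀ i, V.ι i ≃ {b : (u : LcmLattice m) × Fin (t u) // δ b.1 b.2 = i}),
      V.IsObtainedFrom (fun b : (u : LcmLattice m) × Fin (t u) => e b.1 b.2)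
        (fun b => δ b.1 b.2) φ := by
  obtain ⟨κ, _, a, ha⟩ := exists_isBoundaryBasis k m
  obtain ⟨base⟩ := h.nonempty_unique_degree_zero
  obtain ⟨vertex, hvertex⟩ := h.exists_vertex_equiv
  set N := adaptedBasis h.rel ha
  have hsum : ∀ i (b : {b : (u : LcmLattice m) × Fin (t u) // δ b.1 b.2 = i + 1}),
      boundary k r (e b.1.1 b.1.2) =
        ∑ c : {c : (u : LcmLattice m) × Fin (t u) // δ c.1 c.2 = i},
          N.repr (boundary k r (e b.1.1 b.1.2)) (.inl c.1) • e c.1.1 c.1.2 :=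
    fun i b => h.boundary_eq_sum ha b.2
  refine ⟨{
    ι := fun i => {b : (u : LcmLattice m) × Fin (t u) // δ b.1 b.2 = i}
    fin := fun i => inferInstance
    d := fun i => .of fun c b => N.repr (boundary k r (e b.1.1 b.1.2)) (.inl c.1)
    d_comp := ?_
    bounded := ?_
    base := base
    vertex := vertex
    d_vertex := ?_ }, fun i => Equiv.refl _, hsum, hvertex⟩
  · intro i
    ext c b
    -- Expand `d ∘ d = 0` twice in the chains and compare coefficients by their independence.
    have h0 := boundary_boundary (e b.1.1 b.1.2)
    rw [hsum, map_sum] at h0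
    simp only [map_smul] at h0
    rw [Finset.sum_congr rfl fun b' _ => by rw [hsum i b']] at h0
    simp only [Finset.smul_sum, smul_smul] at h0
    rw [Finset.sum_comm] at h0
    simp only [← Finset.sum_smul] at h0
    have := Fintype.linearIndependent_iff.1
      (h.linearIndependent.comp _ (Subtype.val_injective (p := fun b => δ b.1 b.2 = i))) _ h0 c
    simpa [Matrix.mul_apply, mul_comm] using this
  · refine ⟨Finset.univ.sup (fun b : (u : LcmLattice m) × Fin (t u) => δ b.1 b.2) + 1,
      fun i hi => ⟨fun b => ?_⟩⟩
    have := Finset.le_sup (f := fun b : (u : LcmLattice m) × Fin (t u) => δ b.1 b.2)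
      (Finset.mem_univ b.1)
    have hb := b.2
    omega
  · intro c j
    have h1 : boundary k r (e (vertex j).1.1 (vertex j).1.2) = e c.1.1 c.1.2 := by
      obtain ⟨⟨u, i⟩, hc⟩ := c
      obtain rfl := h.eq_one_of_degree hc
      rw [hvertex, boundary_single, h.one.2]
      simp [faceBoundary, Finset.filter_singleton]
    have h2 : e c.1.1 c.1.2 = N (.inl c.1) := (h.adaptedBasis_inl ha _).symm
    rw [Matrix.of_apply, h1, h2]
    simp

/-! ### Matrix entries and multidegrees of a frame obtained from the chains -/

section Frame

variable {V : Frame k r} {φ : ∀ i, V.ι i ≃ {b : (u : LcmLattice m) × Fin (t u) // δ b.1 b.2 = i}}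

theorem frame_d_eq_repr (h : IsFrameFamily m e δ) (ha : IsBoundaryBasis k m a)
    (hV : V.IsObtainedFrom (fun b : (u : LcmLattice m) × Fin (t u) => e b.1 b.2)
      (fun b => δ b.1 b.2) φ) (i : ℕ) (c : V.ι i) (b : V.ι (i + 1)) :
    V.d i c b = (adaptedBasis h.rel ha).repr
      (boundary k r (e (φ (i + 1) b).1.1 (φ (i + 1) b).1.2)) (.inl (φ i c).1) := by
  classical
  have h1 : ∀ b, e b.1 b.2 = adaptedBasis h.rel ha (.inl b) :=
    fun b => (h.adaptedBasis_inl ha b).symm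
  rw [hV.1 i b, map_sum, Finsupp.finsetSum_apply, Finset.sum_eq_single_of_mem c (Finset.mem_univ c)]
  · simp [h1]
  · intro c' _ hc'
    have : (φ i c').1 ≠ (φ i c).1 := fun h => hc' ((φ i).injective (Subtype.ext h))
    simp [h1, this]

theorem lt_of_frame_d_ne_zero (h : IsFrameFamily m e δ)
    (hV : V.IsObtainedFrom (fun b : (u : LcmLattice m) × Fin (t u) => e b.1 b.2)
      (fun b => δ b.1 b.2) φ) {i : ℕ} {c : V.ι i} {b : V.ι (i + 1)} (hcb : V.d i c b ≠ 0) :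
    (φ i c).1.1 < (φ (i + 1) b).1.1 := by
  obtain ⟨κ, _, a, ha⟩ := exists_isBoundaryBasis k m
  rw [h.frame_d_eq_repr ha hV] at hcb
  obtain ⟨b', h1, h2⟩ := h.repr_boundary_ne_zero ha hcb
  cases h1
  exact h2

open Classical in
theorem frame_deg_eq (h : IsFrameFamily m e δ)
    (hV : V.IsObtainedFrom (fun b : (u : LcmLattice m) × Fin (t u) => e b.1 b.2)
      (fun b => δ b.1 b.2) φ) : ∀ (i : ℕ) (b : V.ι i), V.deg m i b = (φ i b).1.1.1
  | 0, b => by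
    rw [Frame.deg, h.eq_one_of_degree (φ 0 b).2]
    rfl
  | 1, b => by
    obtain ⟨j, rfl⟩ := V.vertex.surjective b
    rw [Frame.deg]
    beta_reduce
    rw [Equiv.symm_apply_apply]
    obtain ⟨i, hi⟩ := h.eq_gen_of_degree (φ 1 (V.vertex j)).2
    have h1 := hV.2 j
    dsimp only at h1
    obtain ⟨⟨⟨u, l⟩, hl⟩, hb⟩ : ∃ x, x = φ 1 (V.vertex j) := ⟨_, rfl⟩
    rw [← hb] at h1 hi ⊢
    dsimp only at h1 hi ⊢
    subst hi
    rw [(h.gen i).2] at h1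
    -- Both `i` and `j` name the same vertex chain, and its coefficient at `{i}` forces them to
    -- agree.
    have h2 := congrFun h1 {i}
    by_cases hij : i = j
    · subst hij; rfl
    · simp [hij] at h2
  | i + 2, b => by
    change (Finset.univ.filter fun a => V.d (i + 1) a b ≠ 0).sup (V.deg m (i + 1)) = _
    set w := (Finset.univ.filter fun a => V.d (i + 1) a b ≠ 0).sup (V.deg m (i + 1)) with hw
    have hle : w ≤ (φ (i + 2) b).1.1.1 := by
      refine Finset.sup_le fun c hc => ?_
      rw [frame_deg_eq h hV (i + 1) c]
      exact (h.lt_of_frame_d_ne_zero hV (Finset.mem_filter.1 hc).2).le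
    by_contra hne
    have hlt : w < (φ (i + 2) b).1.1.1 := lt_of_le_of_ne hle hne
    have hmem := hV.1 (i + 1) b
    dsimp only at hmem
    have h1 : boundary k r (e (φ (i + 2) b).1.1 (φ (i + 2) b).1.2) ∈ chainsLE k m w := by
      rw [hmem]
      refine Submodule.sum_mem _ fun c _ => ?_
      by_cases hc : V.d (i + 1) c b = 0
      · simp [hc]
      · refine Submodule.smul_mem _ _ (chainsLE_mono ?_ ((h.rel _).mem _))
        rw [← frame_deg_eq h hV (i + 1) c]
        exact Finset.le_sup (f := V.deg m (i + 1)) (by simp [hc])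
    have hcard := h.card (φ (i + 2) b).1.1 (φ (i + 2) b).1.2
    rw [(φ (i + 2) b).2] at hcard
    -- If the least common multiple `w` were strictly smaller than the label, the boundary would
    -- bound some `y` below `w`. Then the chain minus `y` is a cycle of an acyclic simplex, so the
    -- chain has zero relative class.
    obtain ⟨y, hy, hdy⟩ := exists_boundary_eq h1 (boundary_mem_card hcard) (boundary_boundary _)
    have hy' := chainsLE_le_chainsLT hlt hy
    obtain ⟨v, hv⟩ := exists_gen_le (u := (φ (i + 2) b).1.1) fun h1 => by
      have := (φ (i + 2) b).2
      obtain ⟨⟨⟨u, l⟩, hl⟩, hb⟩ : ∃ x, x = φ (i + 2) b := ⟨_, rfl⟩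
      rw [← hb] at h1
      dsimp only at h1
      subst h1
      have := h.degree_one l
      dsimp only at hl
      omega
    obtain ⟨y', hy'', hdy'⟩ := exists_boundary_eq_of_le hv
      (Submodule.sub_mem _ ((h.rel _).mem (φ (i + 2) b).1.2) (chainsLT_le _ hy'))
      (by rw [map_sub, hdy, sub_self])
    exact h.not_mem_sup _ _ (Submodule.mem_sup.2 ⟨y, hy', _, ⟨y', hy'', rfl⟩, by rw [hdy']; abel⟩)

end Frame

end IsFrameFamily

end

section

variable {n r : ℕ} {k : Type*} [Field k]

/-! ### Homogenization of matrices -/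

section Homogenize

variable {I J K : Type*}

/-- The homogenization of a matrix, with respect to multidegrees of its rows and columns. -/
def homogenize (p : I → (Fin n →₀ ℕ)) (q : J → (Fin n →₀ ℕ)) (M : Matrix I J k) :
    Matrix I J (MvPolynomial (Fin n) k) :=
  .of fun a b => monomial (q b - p a) (M a b)

theorem homogenize_apply (p : I → (Fin n →₀ ℕ)) (q : J → (Fin n →₀ ℕ)) (M : Matrix I J k)
    (a : I) (b : J) : homogenize p q M a b = monomial (q b - p a) (M a b) := rfl

theorem homogenize_zero (p : I → (Fin n →₀ ℕ)) (q : J → (Fin n →₀ ℕ)) :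
    homogenize p q (0 : Matrix I J k) = 0 := by
  ext1 a b
  simp [homogenize_apply]

theorem homogenize_one [DecidableEq I] (p : I → (Fin n →₀ ℕ)) :
    homogenize p p (1 : Matrix I I k) = 1 := by
  ext1 a b
  rw [homogenize_apply]
  by_cases h : a = b
  · subst h; simp
  · simp [h]

theorem homogenize_fromBlocks {I' J' : Type*} (p : I → (Fin n →₀ ℕ)) (p' : I' → (Fin n →₀ ℕ))
    (q : J → (Fin n →₀ ℕ)) (q' : J' → (Fin n →₀ ℕ)) (M : Matrix I J k) (M' : Matrix I' J' k) :
    homogenize (Sum.elim p p') (Sum.elim q q') (Matrix.fromBlocks M 0 0 M') =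
      Matrix.fromBlocks (homogenize p q M) 0 0 (homogenize p' q' M') := by
  ext1 (a | a) (b | b) <;> simp [homogenize_apply]

variable [Fintype J] {p : I → (Fin n →₀ ℕ)} {q : J → (Fin n →₀ ℕ)} {s : K → (Fin n →₀ ℕ)}
  {A : Matrix I J k} {B : Matrix J K k}

/-- On nonzero entries the truncated subtractions are genuine quotients of monomials, and these
telescope. -/
theorem homogenize_mul (hA : ∀ a b, A a b ≠ 0 → p a ≤ q b) (hB : ∀ a b, B a b ≠ 0 → q a ≤ s b) :
    homogenize p q A * homogenize q s B = homogenize p s (A * B) := by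
  ext1 a c
  simp only [Matrix.mul_apply, homogenize_apply, map_sum, monomial_mul]
  refine Finset.sum_congr rfl fun b _ => ?_
  by_cases h1 : A a b = 0
  · simp [h1]
  by_cases h2 : B b c = 0
  · simp [h2]
  rw [add_comm, tsub_add_tsub_cancel (hB _ _ h2) (hA _ _ h1)]

/-- Exactness of homogenized matrices can be tested in each multidegree. -/
theorem exact_homogenize [Fintype K] (hA : ∀ a b, A a b ≠ 0 → p a ≤ q b)
    (hB : ∀ a b, B a b ≠ 0 → q a ≤ s b) (hAB : A * B = 0)
    (h : ∀ (w : Fin n →₀ ℕ) (c : J → k), (∀ b, c b ≠ 0 → q b ≤ w) → A.mulVec c = 0 →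
      ∃ c' : K → k, (∀ d, c' d ≠ 0 → s d ≤ w) ∧ B.mulVec c' = c) :
    Function.Exact (homogenize q s B).mulVecLin (homogenize p q A).mulVecLin := by
  classical
  intro x
  simp only [Set.mem_range, Matrix.mulVecLin_apply]
  constructor
  swap
  · rintro ⟨y, rfl⟩
    rw [Matrix.mulVec_mulVec, homogenize_mul hA hB, hAB, homogenize_zero, Matrix.zero_mulVec]
  intro hx
  -- `c w` is the component of `x` in multidegree `w`, with the monomial factors stripped; the
  -- matrix acts on it by scalars.
  set c : (Fin n →₀ ℕ) → J → k := fun w b => if q b ≤ w then coeff (w - q b) (x b) else 0 with hc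
  have hcw : ∀ w b, c w b ≠ 0 → q b ≤ w := fun w b hb => by
    by_contra h; simp [hc, h] at hb
  have hAc : ∀ w, A.mulVec (c w) = 0 := by
    intro w
    ext a
    have h1 := congrArg (coeff (w - p a)) (congrFun hx a)
    simp only [Matrix.mulVec, dotProduct, homogenize_apply, coeff_sum, Pi.zero_apply, coeff_zero,
      coeff_monomial_mul'] at h1
    simp only [Matrix.mulVec, dotProduct, Pi.zero_apply]
    by_cases hw : p a ≤ w
    · rw [← h1]
      refine Finset.sum_congr rfl fun b _ => ?_
      by_cases hab : A a b = 0
      · simp [hab]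
      have h2 := hA a b hab
      have h3 : q b - p a ≤ w - p a ↔ q b ≤ w := by
        rw [tsub_le_iff_right, tsub_add_cancel_of_le hw]
      simp only [hc, h3]
      split_ifs with h4
      · rw [tsub_tsub_tsub_cancel_right h2]
      · simp
    · refine Finset.sum_eq_zero fun b _ => ?_
      by_cases hab : A a b = 0
      · simp [hab]
      · rw [hc]
        simp only
        rw [if_neg fun h4 => hw ((hA a b hab).trans h4), mul_zero]
  choose c' hc's hc' using fun w => h w (c w) (hcw w) (hAc w)
  -- The finitely many multidegrees in which `x` has a nonzero component.
  set W : Finset (Fin n →₀ ℕ) := Finset.univ.biUnion fun b => (x b).support.image (· + q b) with hW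
  refine ⟨fun d => ∑ w ∈ W, monomial (w - s d) (c' w d), ?_⟩
  ext1 b
  have h1 : ∀ w d, homogenize q s B b d * monomial (w - s d) (c' w d) =
      monomial (w - q b) (B b d * c' w d) := by
    intro w d
    rw [homogenize_apply, monomial_mul]
    by_cases h1 : B b d = 0
    · simp [h1]
    by_cases h2 : c' w d = 0
    · simp [h2]
    rw [add_comm, tsub_add_tsub_cancel (hc's w d h2) (hB b d h1)]
  simp only [Matrix.mulVec, dotProduct, Finset.mul_sum, h1]
  rw [Finset.sum_comm]
  have h2 : ∀ w, ∑ d, monomial (w - q b) (B b d * c' w d) =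
      (monomial (w - q b) (c w b) : MvPolynomial (Fin n) k) := by
    intro w
    rw [← map_sum, ← hc' w]
    rfl
  simp only [h2]
  ext z
  simp only [coeff_sum, coeff_monomial]
  rw [Finset.sum_eq_single (z + q b)]
  · simp [hc]
  -- Truncated subtraction may produce the exponent `z` from another `w`, but then `q b` does not
  -- divide `w` and `c w b` is zero.
  · intro w _ hw
    split_ifs with h3
    · simp only [hc]
      rw [if_neg fun h4 => hw ?_]
      rw [← h3, tsub_add_cancel_of_le h4]
    · rfl
  · intro hz
    have h3 : coeff z (x b) = 0 := by
      by_contra h3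
      refine hz (Finset.mem_biUnion.2 ⟨b, Finset.mem_univ b, Finset.mem_image.2 ⟨z, ?_, rfl⟩⟩)
      exact mem_support_iff.2 h3
    simp [hc, h3]

end Homogenize

/-! ### The homogenization is a minimal free resolution -/

variable {m : Fin r → (Fin n →₀ ℕ)}

/-- The frame entries in degree one are 1, so the first homogenized differential has entries `m_j`
and its image is the ideal itself. -/
theorem Frame.exists_augmentation (V : Frame k r) :
    ∃ ε : ((V.homogenization m).ι 0 → MvPolynomial (Fin n) k) →ₗ[MvPolynomial (Fin n) k]
        MvPolynomial (Fin n) k ⧸ monomialIdeal k m,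
      (∀ (v : (V.homogenization m).ι 0 → MvPolynomial (Fin n) k) (u : Fin n →₀ ℕ),
        (∀ a, v a ≠ 0 → (V.homogenization m).deg 0 a ≤ u ∧
          ∃ c : k, v a = monomial (u - (V.homogenization m).deg 0 a) c) →
        ∃ c : k, ε v = Ideal.Quotient.mk (monomialIdeal k m) (monomial u c)) ∧
      Function.Surjective ε ∧ Function.Exact ((V.homogenization m).d 0).mulVecLin ε := by
  let o : (V.homogenization m).ι 0 := V.base.default
  let vert : Fin r ≃ (V.homogenization m).ι (0 + 1) := V.vertex
  have hd : ∀ j, (V.homogenization m).d 0 o (vert j) = monomial (m j) 1 := by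
    intro j
    change monomial (m (V.vertex.symm (V.vertex j)) - 0) (V.d 0 V.base.default (V.vertex j)) = _
    rw [V.d_vertex, Equiv.symm_apply_apply, tsub_zero]
  refine ⟨(monomialIdeal k m).mkQ ∘ₗ LinearMap.proj o, ?_, ?_, ?_⟩
  · intro v u hv
    by_cases h0 : v o = 0
    · exact ⟨0, by simp [h0]⟩
    · obtain ⟨_, c, hc⟩ := hv o h0
      refine ⟨c, ?_⟩
      rw [LinearMap.comp_apply, LinearMap.proj_apply, hc,
        show (V.homogenization m).deg 0 o = 0 from rfl, tsub_zero]
      rfl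
  · exact (Submodule.mkQ_surjective _).comp (LinearMap.proj_surjective _)
  · intro v
    rw [LinearMap.comp_apply, LinearMap.proj_apply, Submodule.mkQ_apply,
      Submodule.Quotient.mk_eq_zero, monomialIdeal, Ideal.mem_span_range_iff_exists_fun]
    have key : ∀ x : (V.homogenization m).ι (0 + 1) → MvPolynomial (Fin n) k,
        ((V.homogenization m).d 0).mulVecLin x o =
          ∑ j, x (vert j) * monomial (m j) 1 := by
      intro x
      rw [Matrix.mulVecLin_apply]
      simp only [← hd]
      rw [Matrix.mulVec, dotProduct, ← vert.sum_comp]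
      exact Finset.sum_congr rfl fun j _ => mul_comm _ _
    constructor
    · rintro ⟨c, hc⟩
      refine ⟨fun b => c (vert.symm b), funext fun b => ?_⟩
      rw [show b = o from V.base.uniq b, key, ← hc]
      simp
    · rintro ⟨x, rfl⟩
      exact ⟨fun j => x (vert j), (key x).symm⟩

theorem mem_smul_top_of_forall {S ι : Type*} [CommRing S] [Fintype ι] {I : Ideal S} {v : ι → S}
    (hv : ∀ i, v i ∈ I) : v ∈ I • (⊤ : Submodule S (ι → S)) := by
  classical
  rw [pi_eq_sum_univ' v]
  exact Submodule.sum_mem _ fun i _ => Submodule.smul_mem_smul (hv i) trivial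

theorem monomial_mem_span_X {u : Fin n →₀ ℕ} (hu : u ≠ 0) (c : k) :
    monomial u c ∈ Ideal.span (Set.range (X : Fin n → MvPolynomial (Fin n) k)) := by
  obtain ⟨i, hi⟩ := Finsupp.ne_iff.1 hu
  have : monomial u c = monomial (u - Finsupp.single i 1) c * X i := by
    rw [X, monomial_mul, mul_one, tsub_add_cancel_of_le]
    simpa [Nat.one_le_iff_ne_zero] using hi
  rw [this]
  exact Ideal.mul_mem_left _ _ (Ideal.subset_span ⟨i, rfl⟩)

variable {t : LcmLattice m → ℕ} {e : ∀ u : LcmLattice m, Fin (t u) → Chain k r}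
  {δ : ∀ u : LcmLattice m, Fin (t u) → ℕ} {V : Frame k r}
  {φ : ∀ i, V.ι i ≃ {b : (u : LcmLattice m) × Fin (t u) // δ b.1 b.2 = i}}

namespace IsFrameFamily

/-- Projection to the `e`-coordinates commutes with the boundary and does not raise multidegrees, so
a chain bounding the given cycle in the simplex projects to a preimage in the frame. -/
theorem frame_exists_mulVec_eq (h : IsFrameFamily m e δ)
    (hV : V.IsObtainedFrom (fun b : (u : LcmLattice m) × Fin (t u) => e b.1 b.2)
      (fun b => δ b.1 b.2) φ) (i : ℕ) (w : Fin n →₀ ℕ) (c : V.ι (i + 1) → k)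
    (hcw : ∀ b, c b ≠ 0 → V.deg m (i + 1) b ≤ w) (hc : (V.d i).mulVec c = 0) :
    ∃ c' : V.ι (i + 2) → k, (∀ d, c' d ≠ 0 → V.deg m (i + 2) d ≤ w) ∧
      (V.d (i + 1)).mulVec c' = c := by
  obtain ⟨κ, _, a, ha⟩ := exists_isBoundaryBasis k m
  set N := adaptedBasis h.rel ha with hN
  set x : Chain k r := ∑ b, c b • e (φ (i + 1) b).1.1 (φ (i + 1) b).1.2 with hx
  have hxw : x ∈ chainsLE k m w := by
    refine Submodule.sum_mem _ fun b _ => ?_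
    by_cases hb : c b = 0
    · simp [hb]
    · refine Submodule.smul_mem _ _ (chainsLE_mono ?_ ((h.rel _).mem _))
      rw [← h.frame_deg_eq hV]
      exact hcw b hb
  have hxi : x ∈ chains k {A : Finset (Fin r) | A.card = i + 1} := by
    refine Submodule.sum_mem _ fun b _ => Submodule.smul_mem _ _ ?_
    have := h.card (φ (i + 1) b).1.1 (φ (i + 1) b).1.2
    rwa [(φ (i + 1) b).2] at this
  have hdx : boundary k r x = 0 := by
    have h1 : boundary k r x = ∑ d, (V.d i).mulVec c d • e (φ i d).1.1 (φ i d).1.2 := by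
      rw [hx, map_sum]
      simp only [map_smul, Matrix.mulVec, dotProduct, Finset.sum_smul]
      rw [Finset.sum_comm]
      refine Finset.sum_congr rfl fun b _ => ?_
      rw [hV.1 i b, Finset.smul_sum]
      simp only [smul_smul, mul_comm]
    rw [h1, hc]
    simp
  obtain ⟨y, hy, hyx⟩ := exists_boundary_eq hxw hxi hdx
  refine ⟨fun d => N.repr y (.inl (φ (i + 2) d).1), fun d hd => ?_, ?_⟩
  · rw [h.frame_deg_eq hV]
    exact h.mdeg_le_of_repr_ne_zero ha hy hd
  ext b
  have hxb : N.repr x (.inl (φ (i + 1) b).1) = c b := by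
    classical
    rw [hx, map_sum, Finsupp.finsetSum_apply, Finset.sum_eq_single_of_mem b (Finset.mem_univ b)]
    · rw [map_smul, ← h.adaptedBasis_inl ha, ← hN, N.repr_self]
      simp
    · intro b' _ hb'
      have : (φ (i + 1) b').1 ≠ (φ (i + 1) b).1 :=
        fun h => hb' ((φ (i + 1)).injective (Subtype.ext h))
      rw [map_smul, ← h.adaptedBasis_inl ha, ← hN, N.repr_self]
      simp [this]
  rw [← hxb, ← hyx]
  conv_rhs => rw [← N.sum_repr y]
  rw [map_sum, map_sum, Finsupp.finsetSum_apply, Fintype.sum_sum_type,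
    Finset.sum_eq_zero (s := (Finset.univ : Finset (κ ⊕ κ))), add_zero]
  · rw [Matrix.mulVec, dotProduct]
    refine Fintype.sum_of_injective (fun d => (φ (i + 2) d).1)
      (Subtype.val_injective.comp (φ (i + 2)).injective) _ _ (fun b' hb' => ?_) (fun d => ?_)
    -- The bounding chain `y` is not known to be homogeneous; its components outside degree `i + 2`
    -- must be shown not to contribute. Degree 0 is separate, as its boundary is zero.
    · have hb'' : δ b'.1 b'.2 ≠ i + 2 := fun h => hb' ⟨(φ (i + 2)).symm ⟨b', h⟩, by simp⟩
      rw [map_smul, map_smul, Finsupp.smul_apply, hN, h.adaptedBasis_inl ha]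
      by_contra h0
      obtain ⟨h1, h2⟩ := ne_zero_and_ne_zero_of_mul h0
      rcases Nat.eq_zero_or_pos (δ b'.1 b'.2) with h3 | h3
      · have := h.card b'.1 b'.2
        rw [h3] at this
        rw [boundary_eq_zero_of_card this] at h2
        simp at h2
      · obtain ⟨l, hl⟩ := Nat.exists_eq_add_of_lt h3
        rw [zero_add] at hl
        have h4 := h.card b'.1 b'.2
        rw [hl] at h4
        refine h2 (h.repr_of_degree_ne ha (boundary_mem_card h4) ?_)
        have h5 : adaptedDegree δ a (.inl (φ (i + 1) b).1) = i + 1 := (φ (i + 1) b).2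
        rw [h5]
        omega
    · rw [h.frame_d_eq_repr ha hV, map_smul, map_smul, Finsupp.smul_apply, hN,
        h.adaptedBasis_inl ha, smul_eq_mul, mul_comm]
  -- The trivial part maps into itself: a face goes to its boundary, and a boundary to zero.
  · rintro (z | z) -
    · rw [map_smul, map_smul, Finsupp.smul_apply]
      have : boundary k r (N (.inr (.inl z))) = N (.inr (.inr z)) := by
        rw [hN, adaptedBasis_apply, adaptedBasis_apply]
        rfl
      rw [this, N.repr_self]
      simp
    · have : boundary k r (N (.inr (.inr z))) = 0 := by
        rw [hN, adaptedBasis_apply]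
        exact boundary_boundary _
      rw [map_smul, this]
      simp

theorem isMinimalFreeResolution (h : IsFrameFamily m e δ)
    (hV : V.IsObtainedFrom (fun b : (u : LcmLattice m) × Fin (t u) => e b.1 b.2)
      (fun b => δ b.1 b.2) φ) :
    (V.homogenization m).IsMinimalFreeResolution (monomialIdeal k m) := by
  refine ⟨V.exists_augmentation, fun i => ?_, fun i => ?_⟩
  · exact exact_homogenize (V.deg_le m i) (V.deg_le m (i + 1)) (V.d_comp i)
      (h.frame_exists_mulVec_eq hV i)
  · rintro _ ⟨v, rfl⟩
    refine mem_smul_top_of_forall fun (a : V.ι i) => ?_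
    rw [Matrix.mulVecLin_apply]
    refine Ideal.sum_mem _ fun (b : V.ι (i + 1)) _ => Ideal.mul_mem_right _ _ ?_
    change monomial (V.deg m (i + 1) b - V.deg m i a) (V.d i a b) ∈ _
    by_cases hab : V.d i a b = 0
    · simp [hab]
    · refine monomial_mem_span_X (fun h0 => ?_) _
      have := h.lt_of_frame_d_ne_zero hV hab
      rw [h.frame_deg_eq hV, h.frame_deg_eq hV, tsub_eq_zero_iff_le] at h0
      exact absurd this (not_lt_of_ge h0)

end IsFrameFamily

end

section

variable {n r : ℕ} {k : Type*} [Field k]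

/-! ### The change of basis of the Taylor resolution -/

variable {m : Fin r → (Fin n →₀ ℕ)} {κ : Type} {a : κ → Finset (Fin r)}

/-- The matrices of the trivial summand: the basis elements are the faces `a x`, followed by their
boundaries. -/
def trivialMatrix (k : Type*) [Field k] (a : κ → Finset (Fin r)) (i : ℕ) :
    Matrix ({x // (a x).card = i} ⊕ {x // (a x).card = i + 1})
      ({x // (a x).card = i + 1} ⊕ {x // (a x).card = i + 1 + 1}) k :=
  open Classical in Matrix.fromBlocks 0 0 1 0

/-- The multidegrees of the basis elements of the trivial summand. -/
def trivialMdeg (m : Fin r → (Fin n →₀ ℕ)) (a : κ → Finset (Fin r)) (i : ℕ) :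
    {x // (a x).card = i} ⊕ {x // (a x).card = i + 1} → (Fin n →₀ ℕ) :=
  Sum.elim (fun x => mdeg m (a x.1)) fun x => mdeg m (a x.1)

theorem trivialMdeg_le (i : ℕ) (b c) (h : trivialMatrix k a i b c ≠ 0) :
    trivialMdeg m a i b ≤ trivialMdeg m a (i + 1) c := by
  rcases b with b | b <;> rcases c with c | c
  · simp [trivialMatrix] at h
  · simp [trivialMatrix] at h
  · by_cases hbc : b = c
    · subst hbc; rfl
    · simp [trivialMatrix, hbc] at h
  · simp [trivialMatrix] at h

/-- The trivial summand of the Taylor resolution with the faces `a x` and their boundaries as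
its basis. -/
def trivialSummand [Fintype κ] (k : Type*) [Field k] (m : Fin r → (Fin n →₀ ℕ)) (a : κ → Finset (Fin r)) :
    MultigradedComplex k n :=
  .ofScalars (trivialMdeg m a) (trivialMatrix k a)
    (fun i => by classical simp [trivialMatrix, Matrix.fromBlocks_multiply])
    ⟨r + 1, fun i hi => ⟨by
      have : ∀ x, (a x).card ≤ r := fun x => by simpa using Finset.card_le_univ (a x)
      rintro (⟨x, hx⟩ | ⟨x, hx⟩) <;> have := this x <;> omega⟩⟩
    trivialMdeg_le

theorem mdegBoundary_single_of_card {A : Finset (Fin r)} (hA : A.card = 0) :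
    mdegBoundary k m (Pi.single A 1) = 0 := by
  obtain rfl := Finset.card_eq_zero.1 hA
  simp [mdegBoundary_single, faceBoundary]

theorem IsBoundaryBasis.card_ne_zero (ha : IsBoundaryBasis k m a) (x : κ) : (a x).card ≠ 0 :=
  fun h => ha.indep.ne_zero x (mdegBoundary_single_of_card h)

/-- The pairing of the boundaries of the faces `a x` with these faces. -/
def trivialPair (a : κ → Finset (Fin r)) (i : ℕ) :
    ↥(Set.range (Sum.inl : {x // (a x).card = i} → _ ⊕ {x // (a x).card = i + 1}))ᶜ ≃
      ↥(Set.range (Sum.inl : {x // (a x).card = i + 1} → _ ⊕ {x // (a x).card = i + 1 + 1})) :=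
  (Equiv.setCongr Set.compl_range_inl).trans
    ((Equiv.ofInjective _ Sum.inr_injective).symm.trans (Equiv.ofInjective _ Sum.inl_injective))

theorem trivialPair_inr (i : ℕ) (x : {x // (a x).card = i + 1}) (hx) :
    (trivialPair a i ⟨.inr x, hx⟩).1 = .inl x :=
  have : (Equiv.ofInjective (Sum.inr : _ → {x // (a x).card = i} ⊕ _) Sum.inr_injective).symm
      ⟨.inr x, x, rfl⟩ = x := Equiv.ofInjective_symm_apply _ _
  congrArg Sum.inl this

theorem monomial_trivialMatrix (i : ℕ) (b : {x // (a x).card = i} ⊕ {x // (a x).card = i + 1})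
    (x : {x // (a x).card = i + 1}) [Decidable (b = .inr x)] :
    monomial (trivialMdeg m a (i + 1) (.inl x) - trivialMdeg m a i b)
      (trivialMatrix k a i b (.inl x)) = if b = .inr x then 1 else 0 := by
  rcases b with b | b
  · simp [trivialMatrix]
  · by_cases hb : b = x
    · subst hb
      simp [trivialMatrix, trivialMdeg]
    · simp [trivialMatrix, hb]

theorem trivialSummand_isTrivial [Fintype κ] (ha : ∀ x, (a x).card ≠ 0) :
    (trivialSummand k m a).IsTrivial := by
  classical
  refine ⟨fun i => Set.range Sum.inl, trivialPair a, ?_, ?_, ?_, ?_⟩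
  -- A source in degree 0 would be the empty face, which is never among the `a x`.
  · exact Set.range_eq_empty_iff.2 ⟨fun x => ha x.1 x.2⟩
  · rintro i ⟨x | x, hx⟩
    · exact absurd ⟨x, rfl⟩ hx
    · exact congrArg (trivialMdeg m a (i + 1)) (trivialPair_inr i x hx)
  · rintro i b (c | c) hc
    · exact absurd ⟨c, rfl⟩ hc
    · change monomial _ (trivialMatrix k a i b (.inr c)) = 0
      rcases b with b | b <;> simp [trivialMatrix]
  · rintro i b ⟨x | x, hx⟩
    · exact absurd ⟨x, rfl⟩ hx
    · exact (congrArg (fun c => monomial (trivialMdeg m a (i + 1) c - trivialMdeg m a i b)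
        (trivialMatrix k a i b c)) (trivialPair_inr i x hx)).trans (monomial_trivialMatrix i b x)

variable {t : LcmLattice m → ℕ} {e : ∀ u : LcmLattice m, Fin (t u) → Chain k r}
  {δ : ∀ u : LcmLattice m, Fin (t u) → ℕ} {V : Frame k r}
  {φ : ∀ i, V.ι i ≃ {b : (u : LcmLattice m) × Fin (t u) // δ b.1 b.2 = i}}

/-- The elements of homological degree `i` in the adapted basis. -/
def adaptedIndexOfDegree (φ : ∀ i, V.ι i ≃ {b : (u : LcmLattice m) × Fin (t u) // δ b.1 b.2 = i})
    (a : κ → Finset (Fin r)) (i : ℕ) :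
    V.ι i ⊕ ({x // (a x).card = i} ⊕ {x // (a x).card = i + 1}) → AdaptedIndex t κ :=
  Sum.elim (fun b => .inl (φ i b).1) (Sum.elim (fun x => .inr (.inl x.1)) fun x => .inr (.inr x.1))

theorem adaptedIndexOfDegree_injective (i : ℕ) :
    Function.Injective (adaptedIndexOfDegree φ a i) := by
  rintro (b | b | b) (c | c | c) h <;> simp [adaptedIndexOfDegree] at h
  · rw [(φ i).injective (Subtype.ext h)]
  · rw [Subtype.ext h]
  · rw [Subtype.ext h]

theorem adaptedDegree_adaptedIndexOfDegree (i : ℕ) (b) :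
    adaptedDegree δ a (adaptedIndexOfDegree φ a i b) = i := by
  rcases b with b | b | b
  · exact (φ i b).2
  · exact b.2
  · have := b.2
    change (a b.1).card - 1 = i
    omega

theorem mem_range_adaptedIndexOfDegree (ha : IsBoundaryBasis k m a) {i : ℕ} {b : AdaptedIndex t κ}
    (hb : adaptedDegree δ a b = i) : b ∈ Set.range (adaptedIndexOfDegree φ a i) := by
  rcases b with b | x | x
  · exact ⟨.inl ((φ i).symm ⟨b, hb⟩), by simp [adaptedIndexOfDegree]⟩
  · exact ⟨.inr (.inl ⟨x, hb⟩), rfl⟩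
  -- The degree `(a x).card - 1` is a truncated subtraction; it is the true degree because `a x` is
  -- nonempty.
  · refine ⟨.inr (.inr ⟨x, ?_⟩), rfl⟩
    have := ha.card_ne_zero x
    change (a x).card - 1 = i at hb
    omega

/-- The matrices of the augmented chain complex of the full simplex. -/
def taylorMatrix (k : Type*) [Field k] (r i : ℕ) :
    Matrix {A : Finset (Fin r) // A.card = i} {A : Finset (Fin r) // A.card = i + 1} k :=
  .of fun A B => faceBoundary k B.1 A.1

theorem taylorMatrix_mdeg_le {i : ℕ} (A B) (h : taylorMatrix k r i A B ≠ 0) :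
    mdeg m A.1 ≤ mdeg m B.1 := by
  by_contra hle
  exact h (faceBoundary_apply_eq_zero fun hs => hle (Finset.sup_mono hs.1))

/-! ### The matrices of the adapted basis and the Taylor basis -/

namespace IsFrameFamily

/-- The matrix of the adapted basis in homological degree `i`. -/
def basisMatrix (e : ∀ u : LcmLattice m, Fin (t u) → Chain k r)
    (φ : ∀ i, V.ι i ≃ {b : (u : LcmLattice m) × Fin (t u) // δ b.1 b.2 = i})
    (a : κ → Finset (Fin r)) (i : ℕ) :
    Matrix {A : Finset (Fin r) // A.card = i}
      (V.ι i ⊕ ({x // (a x).card = i} ⊕ {x // (a x).card = i + 1})) k :=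
  .of fun A b => adaptedFamily e a (adaptedIndexOfDegree φ a i b) A.1

/-- The inverse of the matrix of the adapted basis in homological degree `i`. -/
def basisMatrixInv [Fintype κ] (h : IsFrameFamily m e δ) (ha : IsBoundaryBasis k m a)
    (φ : ∀ i, V.ι i ≃ {b : (u : LcmLattice m) × Fin (t u) // δ b.1 b.2 = i}) (i : ℕ) :
    Matrix (V.ι i ⊕ ({x // (a x).card = i} ⊕ {x // (a x).card = i + 1}))
      {A : Finset (Fin r) // A.card = i} k :=
  .of fun b A => (adaptedBasis h.rel ha).repr (Pi.single A.1 1) (adaptedIndexOfDegree φ a i b)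

theorem adaptedFamily_apply_eq_zero (h : IsFrameFamily m e δ) {b : AdaptedIndex t κ}
    {A : Finset (Fin r)} (hA : A.card ≠ adaptedDegree δ a b) : adaptedFamily e a b A = 0 :=
  h.adaptedFamily_mem_card b A hA

theorem basisMatrix_mul_inv [Fintype κ] (h : IsFrameFamily m e δ) (ha : IsBoundaryBasis k m a) (i : ℕ) :
    basisMatrix e φ a i * basisMatrixInv h ha φ i = 1 := by
  ext A A'
  have h1 := congrFun ((adaptedBasis h.rel ha).sum_repr (Pi.single A'.1 1)) A.1
  rw [Finset.sum_apply] at h1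
  have h2 : (Pi.single A'.1 1 : Chain k r) A.1 = (1 : Matrix _ _ k) A A' := by
    rw [Pi.single_apply, Matrix.one_apply]
    simp only [Subtype.ext_iff]
  rw [← h2, ← h1, Matrix.mul_apply]
  refine Fintype.sum_of_injective (adaptedIndexOfDegree φ a i) (adaptedIndexOfDegree_injective i)
    _ _ (fun b hb => ?_) (fun b => ?_)
  · have hb' : adaptedDegree δ a b ≠ i := fun h => hb (mem_range_adaptedIndexOfDegree ha h)
    rw [h.repr_of_degree_ne ha (single_mem_chains A'.2 1) hb']
    simp
  · simp [basisMatrix, basisMatrixInv, adaptedBasis_apply, mul_comm]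

theorem inv_mul_basisMatrix [Fintype κ] (h : IsFrameFamily m e δ) (ha : IsBoundaryBasis k m a) (i : ℕ) :
    open Classical in basisMatrixInv h ha φ i * basisMatrix e φ a i = 1 := by
  classical
  ext b b'
  set N := adaptedBasis h.rel ha with hN
  set ψ := adaptedIndexOfDegree φ a i with hψ
  have h1 : N.repr (N (ψ b')) (ψ b) = (1 : Matrix _ _ k) b b' := by
    rw [N.repr_self, Matrix.one_apply]
    split_ifs with hb
    · rw [hb, Finsupp.single_eq_same]
    · exact Finsupp.single_eq_of_ne fun h => hb (adaptedIndexOfDegree_injective i h)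
  rw [← h1]
  conv_rhs => rw [chain_eq_sum (N (ψ b'))]
  rw [map_sum, Finsupp.finsetSum_apply, Matrix.mul_apply]
  refine Fintype.sum_of_injective _ Subtype.val_injective _ _ (fun A hA => ?_) (fun A => ?_)
  · have hA' : A.card ≠ adaptedDegree δ a (ψ b') := by
      rw [adaptedDegree_adaptedIndexOfDegree]
      exact fun h => hA ⟨⟨A, h⟩, rfl⟩
    rw [hN, adaptedBasis_apply, h.adaptedFamily_apply_eq_zero hA']
    simp
  · simp [basisMatrix, basisMatrixInv, hN, hψ, adaptedBasis_apply, mul_comm]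

theorem adaptedMdeg_adaptedIndexOfDegree (h : IsFrameFamily m e δ)
    (hV : V.IsObtainedFrom (fun b : (u : LcmLattice m) × Fin (t u) => e b.1 b.2)
      (fun b => δ b.1 b.2) φ) (i : ℕ) (b) :
    adaptedMdeg t a (adaptedIndexOfDegree φ a i b) =
      Sum.elim (V.deg m i) (trivialMdeg m a i) b := by
  rcases b with b | b | b
  · exact (h.frame_deg_eq hV i b).symm
  · rfl
  · rfl

theorem basisMatrix_mdeg_le (h : IsFrameFamily m e δ)
    (hV : V.IsObtainedFrom (fun b : (u : LcmLattice m) × Fin (t u) => e b.1 b.2)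
      (fun b => δ b.1 b.2) φ) (i : ℕ) (A b) (hA : basisMatrix e φ a i A b ≠ 0) :
    mdeg m A.1 ≤ Sum.elim (V.deg m i) (trivialMdeg m a i) b := by
  rw [← h.adaptedMdeg_adaptedIndexOfDegree hV]
  exact mem_of_apply_ne_zero (adaptedFamily_mem h.rel _) hA

theorem basisMatrixInv_mdeg_le [Fintype κ] (h : IsFrameFamily m e δ) (ha : IsBoundaryBasis k m a)
    (hV : V.IsObtainedFrom (fun b : (u : LcmLattice m) × Fin (t u) => e b.1 b.2)
      (fun b => δ b.1 b.2) φ) (i : ℕ) (b) (A : {A : Finset (Fin r) // A.card = i})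
    (hA : basisMatrixInv h ha φ i b A ≠ 0) :
    Sum.elim (V.deg m i) (trivialMdeg m a i) b ≤ mdeg m A.1 := by
  rw [← h.adaptedMdeg_adaptedIndexOfDegree hV]
  exact h.mdeg_le_of_repr_ne_zero ha (single_mem_chainsLE A.1 1) hA

/-- The splitting over `k`: the frame block is closed under the boundary by `IsObtainedFrom`, and
the other block pairs each `a x` with its boundary. -/
theorem taylorMatrix_mul_basisMatrix [Fintype κ] (h : IsFrameFamily m e δ)
    (hV : V.IsObtainedFrom (fun b : (u : LcmLattice m) × Fin (t u) => e b.1 b.2)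
      (fun b => δ b.1 b.2) φ) (i : ℕ) :
    taylorMatrix k r i * basisMatrix e φ a (i + 1) =
      basisMatrix e φ a i * Matrix.fromBlocks (V.d i) 0 0 (trivialMatrix k a i) := by
  classical
  ext A b
  have h1 : (taylorMatrix k r i * basisMatrix e φ a (i + 1)) A b =
      boundary k r (adaptedFamily e a (adaptedIndexOfDegree φ a (i + 1) b)) A.1 := by
    rw [boundary, Fintype.linearCombination_apply, Finset.sum_apply, Matrix.mul_apply]
    refine Fintype.sum_of_injective _ Subtype.val_injective _ _ (fun B hB => ?_) (fun B => ?_)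
    · rw [h.adaptedFamily_apply_eq_zero, zero_smul, Pi.zero_apply]
      rw [adaptedDegree_adaptedIndexOfDegree]
      exact fun h => hB ⟨⟨B, h⟩, rfl⟩
    · simp [basisMatrix, taylorMatrix, mul_comm]
  rw [h1, Matrix.mul_apply, Fintype.sum_sum_type, Fintype.sum_sum_type]
  rcases b with b | x | x
  · have h2 := congrFun (hV.1 i b) A.1
    dsimp only at h2
    change boundary k r (e (φ (i + 1) b).1.1 (φ (i + 1) b).1.2) A.1 = _
    rw [h2, Finset.sum_apply]
    simp [basisMatrix, adaptedIndexOfDegree, adaptedFamily, mul_comm]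
  · simp [basisMatrix, adaptedIndexOfDegree, adaptedFamily, trivialMatrix, Matrix.one_apply]
  · change boundary k r (boundary k r (Pi.single (a x.1) 1)) A.1 = _
    simp [boundary_boundary, trivialMatrix]

/-- The basis matrix and its inverse both respect multidegrees, so their homogenizations are
mutually inverse over the polynomial ring, and the scalar splitting homogenizes with them. -/
theorem isTaylorBasis (h : IsFrameFamily m e δ)
    (hV : V.IsObtainedFrom (fun b : (u : LcmLattice m) × Fin (t u) => e b.1 b.2)
      (fun b => δ b.1 b.2) φ) :
    IsTaylorBasis m (V.homogenization m) fun i b => e (φ i b).1.1 (φ i b).1.2 := by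
  classical
  obtain ⟨κ, _, a, ha⟩ := exists_isBoundaryBasis k m
  set p : ∀ i, {A : Finset (Fin r) // A.card = i} → (Fin n →₀ ℕ) := fun i A => mdeg m A.1 with hp
  set q : ∀ i, V.ι i ⊕ ({x // (a x).card = i} ⊕ {x // (a x).card = i + 1}) → (Fin n →₀ ℕ) :=
    fun i => Sum.elim (V.deg m i) (trivialMdeg m a i) with hq
  have hPQ : ∀ i, homogenize (p i) (q i) (basisMatrix e φ a i) *
      homogenize (q i) (p i) (basisMatrixInv h ha φ i) = 1 := fun i => by
    rw [homogenize_mul (h.basisMatrix_mdeg_le hV i) (h.basisMatrixInv_mdeg_le ha hV i),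
      h.basisMatrix_mul_inv ha, homogenize_one]
  have hQP : ∀ i, homogenize (q i) (p i) (basisMatrixInv h ha φ i) *
      homogenize (p i) (q i) (basisMatrix e φ a i) = 1 := fun i => by
    rw [homogenize_mul (h.basisMatrixInv_mdeg_le ha hV i) (h.basisMatrix_mdeg_le hV i)]
    convert homogenize_one (q i)
    exact h.inv_mul_basisMatrix ha i
  -- The new basis consists of the columns of the invertible homogenized matrix.
  set f : ∀ i, Module.Basis (V.ι i ⊕ ({x // (a x).card = i} ⊕ {x // (a x).card = i + 1}))
      (MvPolynomial (Fin n) k) ({A : Finset (Fin r) // A.card = i} → MvPolynomial (Fin n) k) :=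
    fun i => (Pi.basisFun _ _).map (Matrix.toLin'OfInv (hQP i) (hPQ i)) with hf
  have hfb : ∀ i b A, f i b A = monomial (q i b - p i A) (basisMatrix e φ a i A b) := by
    intro i b A
    have : f i b = Matrix.toLin' (homogenize (p i) (q i) (basisMatrix e φ a i)) (Pi.single b 1) := by
      rw [hf, Module.Basis.map_apply, Pi.basisFun_apply]
      rfl
    rw [this, Matrix.toLin'_apply, Matrix.mulVec_single_one]
    rfl
  have h1 : ∀ i b A, f i b A ≠ 0 → p i A ≤ q i b ∧
      ∃ c : k, f i b A = monomial (q i b - p i A) c := by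
    intro i b A hA
    rw [hfb] at hA ⊢
    refine ⟨h.basisMatrix_mdeg_le hV i A b ?_, _, rfl⟩
    intro h0
    exact hA (by rw [h0, map_zero])
  have h2 : ∀ i b, (homogenize (p i) (p (i + 1)) (taylorMatrix k r i)).mulVec (f (i + 1) b) =
      ∑ c, Matrix.fromBlocks (homogenize (V.deg m i) (V.deg m (i + 1)) (V.d i)) 0 0
        (homogenize (trivialMdeg m a i) (trivialMdeg m a (i + 1)) (trivialMatrix k a i)) c b •
          f i c := by
    intro i b
    have h3 := congrArg (homogenize (p i) (q (i + 1))) (h.taylorMatrix_mul_basisMatrix (a := a) hV i)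
    rw [← homogenize_mul (q := p (i + 1)) taylorMatrix_mdeg_le (h.basisMatrix_mdeg_le hV (i + 1)),
      ← homogenize_mul (q := q i) (h.basisMatrix_mdeg_le hV i) ?_, homogenize_fromBlocks] at h3
    · ext1 A
      have h4 := congrFun (congrFun h3 A) b
      rw [Matrix.mul_apply, Matrix.mul_apply] at h4
      simp only [Matrix.mulVec, dotProduct, hfb, Finset.sum_apply, Pi.smul_apply, smul_eq_mul]
      refine h4.trans (Finset.sum_congr rfl fun c _ => mul_comm _ _)
    · rintro (c | c) (c' | c') hc
      · exact V.deg_le m i c c' hc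
      · exact absurd rfl hc
      · exact absurd rfl hc
      · exact trivialMdeg_le i c c' hc
  refine ⟨trivialSummand k m a, f, trivialSummand_isTrivial ha.card_ne_zero, ⟨h1, h2⟩, fun i b => ?_⟩
  change _ = ∑ A : {A : Finset (Fin r) // A.card = i},
    (Pi.single A.1 (eval (fun _ => (1 : k)) (f i (.inl b) A)) : Chain k r)
  -- At `x = 1` the monomials disappear and the scalar column, that is the chain itself, is
  -- recovered.
  simp only [hfb, eval_monomial, one_pow, Finsupp.prod, Finset.prod_const_one, mul_one]
  rw [chain_eq_sum (e _ _)]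
  refine (Fintype.sum_of_injective _ Subtype.val_injective _ _ (fun A hA => ?_) (fun A => ?_)).symm
  · rw [h.card _ _ A, zero_smul]
    rw [(φ i b).2]
    exact fun h => hA ⟨⟨A, h⟩, rfl⟩
  · rw [← Pi.single_smul, smul_eq_mul, mul_one]
    rfl

end IsFrameFamily

end

/-! ### Homology bases of the lcm-lattice -/

theorem isFrameFamily_of_isHomologyBasis {k : Type*} [Field k] {n r : ℕ}
    {m : Fin r → (Fin n →₀ ℕ)} (hmin : IsMinimalGenerators k m) (hproper : monomialIdeal k m ≠ ⊤)
    {t : LcmLattice m → ℕ} {e : ∀ u : LcmLattice m, Fin (t u) → Chain k r}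
    {δ : ∀ u : LcmLattice m, Fin (t u) → ℕ}
    (hδ : ∀ u j, e u j ∈ chains k {A : Finset (Fin r) | A.card = δ u j})
    (h_one : t (LcmLattice.one m) = 1 ∧ ∀ j, e (LcmLattice.one m) j = Pi.single ∅ 1)
    (h_gen : ∀ i, t (LcmLattice.gen m i) = 1 ∧
      ∀ j, e (LcmLattice.gen m i) j = Pi.single {i} 1)
    (h_simplex : ∀ u, 2 ≤ rank m u → ∀ j, e u j ∈ chains k (simplexAt m u))
    (h_basis : ∀ u, 2 ≤ rank m u →
      IsHomologyBasis (complexAt m u) fun j => boundary k r (e u j))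
    (h_comb : ∀ u, u ≠ LcmLattice.one m → ∀ j, boundary k r (e u j) ∈
      Submodule.span k {c | ∃ v, v < u ∧ ∃ i, c = e v i}) :
    IsFrameFamily m e δ := by
  have hne := ne_zero_of_monomialIdeal_ne_top hproper
  have heq := hmin.eq_of_le
  have huniq : ∀ u, t u = 1 → Nonempty (Unique (Fin (t u))) := fun u hu => by
    rw [hu]; exact ⟨inferInstance⟩
  refine ⟨hne, heq, hδ, h_one, h_gen, fun u => ?_, fun u j => ?_⟩
  · by_cases h1 : u = LcmLattice.one m
    · subst h1
      obtain ⟨_⟩ := huniq _ h_one.1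
      exact isRelHomologyBasis_one hne h_one.2
    by_cases h2 : ∃ i, u = LcmLattice.gen m i
    · obtain ⟨i, rfl⟩ := h2
      obtain ⟨_⟩ := huniq _ (h_gen i).1
      exact isRelHomologyBasis_gen hne heq i (h_gen i).2
    have hu : 2 ≤ rank m u := two_le_rank hne h1 (not_exists.1 h2)
    obtain ⟨v, hv⟩ := exists_gen_le h1
    exact .of_isHomologyBasis hv (h_simplex u hu) (h_basis u hu)
  · by_cases h1 : u = LcmLattice.one m
    · subst h1
      rw [h_one.2, boundary_single]
      simp [faceBoundary]
    · exact h_comb u h1 j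

end

end MonomialResolution

theorem mainTheorem5 {k : Type*} [Field k] {n r : ℕ}
    -- the monomials `m_1, …, m_r` minimally generate a proper monomial ideal `M`
    (m : Fin r → (Fin n →₀ ℕ))
    (hmin : IsMinimalGenerators k m) (hproper : monomialIdeal k m ≠ ⊤)
    -- the chains `e u j = e_j^u` for `u` in the lcm-lattice, of homological degree `δ u j`
    (t : LcmLattice m → ℕ)
    (e : ∀ u : LcmLattice m, Fin (t u) → Chain k r)
    (δ : ∀ u : LcmLattice m, Fin (t u) → ℕ)
    (hδ : ∀ u j, e u j ∈ chains k {A : Finset (Fin r) | A.card = δ u j})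
    (h_one : t (LcmLattice.one m) = 1 ∧ ∀ j, e (LcmLattice.one m) j = Pi.single ∅ 1)
    (h_gen : ∀ i, t (LcmLattice.gen m i) = 1 ∧
      ∀ j, e (LcmLattice.gen m i) j = Pi.single {i} 1)
    (h_simplex : ∀ u, 2 ≤ rank m u → ∀ j, e u j ∈ chains k (simplexAt m u))
    (h_basis : ∀ u, 2 ≤ rank m u →
      IsHomologyBasis (complexAt m u) fun j => boundary k r (e u j))
    (h_comb : ∀ u, u ≠ LcmLattice.one m → ∀ j, boundary k r (e u j) ∈
      Submodule.span k {c | ∃ v, v < u ∧ ∃ i, c = e v i}) :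
    -- the complex `V` obtained by applying `d` to the chains is an `r`-frame
    (∃ (V : Frame k r) (φ : ∀ i, V.ι i ≃ {b : (u : LcmLattice m) × Fin (t u) // δ b.1 b.2 = i}),
      V.IsObtainedFrom (fun b : (u : LcmLattice m) × Fin (t u) => e b.1 b.2)
        (fun b => δ b.1 b.2) φ) ∧
    -- its homogenization is a minimal free resolution of `S / M` with the chains as Taylor basis
    ∀ (V : Frame k r) (φ : ∀ i, V.ι i ≃ {b : (u : LcmLattice m) × Fin (t u) // δ b.1 b.2 = i}),
      V.IsObtainedFrom (fun b : (u : LcmLattice m) × Fin (t u) => e b.1 b.2)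
        (fun b => δ b.1 b.2) φ →
      (V.homogenization m).IsMinimalFreeResolution (monomialIdeal k m) ∧
      IsTaylorBasis m (V.homogenization m) fun i b => e (φ i b).1.1 (φ i b).1.2 := by
  have h := isFrameFamily_of_isHomologyBasis hmin hproper hδ h_one h_gen h_simplex h_basis h_comb
  exact ⟨h.exists_frame, fun V φ hV => ⟨h.isMinimalFreeResolution hV, h.isTaylorBasis hV⟩⟩
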